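/- Let $E$ be a countable set, $a,b\colon E\to\mathbb R$ with $\alpha_e:=b(e)-a(e)>0$ for all $e\in E$, and let $P_1\in\mathbb C^{d\times d}$ be Hermitian and invertible, $P_1=S^\star\Delta S$ with $S$ unitary and $\Delta=\operatorname{diag}(\mu_1,\dots,\mu_d)=\operatorname{diag}(\Lambda,-\Theta)$, $\Lambda=\operatorname{diag}(\lambda_1,\dots,\lambda_{n_+})$, $\Theta=\operatorname{diag}(\theta_1,\dots,\theta_{n_-})$, $\lambda_k,\theta_j>0$. Let $$A\colon \bigoplus_{e\in E} H^1_0(a(e),b(e))\subseteq \bigoplus_{e\in E} L^2(a(e),b(e);\mathbb C^d)\to \bigoplus_{e\in E} L^2(a(e),b(e);\mathbb C^d),\quad (\phi_e)_{e}\mapsto ((P_1\phi_e)')_{e},$$ (Hilbert space direct sums) and let $\tilde A$ be the operator $A$ in the case $a(e)=0$, $b(e)=1$ for all $e\in E$. A linear operator $H$ is dissipative if $\operatorname{Re}\langle Hx,x\rangle\le 0$ for all $x\in D(H)$, and maximal dissipative if moreover it has no proper dissipative extension. For $\sigma=\pm1$ let $U_\sigma\colon \ker(1-\sigma A^\star)\to\ker(1-\sigma\tilde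 A^\star)$ be the unitary map that acts edgewise and in each coordinate $k$ with respect to the eigenbasis of $P_1$ (that is, on $(Sx_e)_k$), sending $t\mapsto e^{-\sigma (t-a(e))/\mu_k}$ on $(a(e),b(e))$ to the positive multiple of $t\mapsto e^{-\sigma t/\mu_k}$ on $(0,1)$ with the same $L^2$-norm. Then there is a bijection $\Phi$ from the set of maximal dissipative extensions $H$ of $-A$ onto the set of maximal dissipative extensions $\tilde H$ of $-\tilde A$ such that $H$ and $\Phi(H)$ have the same parameter: for each $H$ there is a contraction $T\colon\ker(1+\tilde A^\star)\to\ker(1-\tilde A^\star)$ with $$D(H)=\{x_0+x_1+x_2\,;\;x_0\in D(A),\ x_1\in\ker(1-A^\star),\ x_2\in\ker(1+A^\star),\ TU_{-1}x_2=U_1x_1\},$$ $$D(\Phi(H))=\{y_0+Ty_2+y_2\,;\;y_0\in D(\tilde A),\ y_2\in\ker(1+\tilde A^\star)\}.$$ Moreover, let $\operatorname{pr}_+,\operatorname{pr}_-$ be the projections of $\mathbb C^d$ onto the first $n_+$ and the last $n_-$ coordinates, and let $$\mathcal G_1=\bigoplus_{e\in E}\mathbb C^{n_+}\oplus\bigoplus_{e\in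 E}\mathbb C^{n_-},\qquad \mathcal G_2=\bigoplus_{e\in E}\mathbb C^{n_-}\oplus\bigoplus_{e\in E}\mathbb C^{n_+}$$ where $\mathbb C^{n_+}$ carries the scalar product $\langle\cdot,\Lambda\,\cdot\rangle$ and $\mathbb C^{n_-}$ carries $\langle\cdot,\Theta\,\cdot\rangle$. For $x\in D(\tilde A^\star)$ the trace vectors below belong to $\mathcal G_2$ and $\mathcal G_1$, respectively, and for every maximal dissipative extension $H$ of $-A$ there is a unique contraction $\tilde T\colon\mathcal G_2\to\mathcal G_1$ such that $$D(\Phi(H))=\biggl\{x\in D(\tilde A^\star)\,;\;\tilde T\begin{bmatrix}(\operatorname{pr}_-(Sx_e)(0))_{e\in E}\\(\operatorname{pr}_+(Sx_e)(1))_{e\in E}\end{bmatrix}=\begin{bmatrix}(\operatorname{pr}_+(Sx_e)(0))_{e\in E}\\(\operatorname{pr}_-(Sx_e)(1))_{e\in E}\end{bmatrix}\biggr\}.$$ -/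

import Mathlib

open MeasureTheory Set Matrix

/-! ### First order differential operators on a network -/

/-- `⨁_{e ∈ E} L²((a e, b e); ℂᵈ)`, a Hilbert space direct sum. -/
abbrev NetL2 {E : Type*} (d : ℕ) (a b : E → ℝ) : Type _ :=
  lp (fun e : E => Lp (EuclideanSpace ℂ (Fin d)) 2 (volume.restrict (Ioo (a e) (b e)))) 2

/-- `g` is the derivative of `f` on `(a, b)` in the sense of distributions. -/
def HasWeakDeriv {d : ℕ} (a b : ℝ) (f g : ℝ → EuclideanSpace ℂ (Fin d)) : Prop :=
  ∀ φ : ℝ → ℝ, ContDiff ℝ (⊤ : ℕ∞) φ → HasCompactSupport φ → tsupport φ ⊆ Ioo a b →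
    ∫ t in Ioo a b, deriv φ t • f t = -∫ t in Ioo a b, φ t • g t

/-- `u` is a representative of `f` on `(a, b)` that is continuous up to the endpoints. -/
def IsContRep {d : ℕ} (a b : ℝ) (f u : ℝ → EuclideanSpace ℂ (Fin d)) : Prop :=
  ContinuousOn u (Icc a b) ∧ ∀ᵐ t ∂(volume.restrict (Ioo a b)), f t = u t

/-- A function in `L²(a, b)`, multiplied by a smooth compactly supported function and a matrix,
is integrable. -/
lemma integrable_test_smul {d : ℕ} {a b : ℝ} {φ : ℝ → ℝ} (hφ : Continuous φ)
    (hc : HasCompactSupport φ) (x : Lp (EuclideanSpace ℂ (Fin d)) 2 (volume.restrict (Ioo a b))) :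
    Integrable (fun t => φ t • x t) (volume.restrict (Ioo a b)) := by
  have hx : Integrable x (volume.restrict (Ioo a b)) := (Lp.memLp x).integrable (by norm_num)
  obtain ⟨C, hC⟩ := hc.exists_bound_of_continuous hφ
  exact hx.bdd_smul C hφ.aestronglyMeasurable (Filter.Eventually.of_forall hC)

lemma integrable_test_smul_matrix {d : ℕ} (P : Matrix (Fin d) (Fin d) ℂ) {a b : ℝ} {φ : ℝ → ℝ}
    (hφ : Continuous φ) (hc : HasCompactSupport φ)
    (x : Lp (EuclideanSpace ℂ (Fin d)) 2 (volume.restrict (Ioo a b))) :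
    Integrable (fun t => φ t • P.toEuclideanLin (x t)) (volume.restrict (Ioo a b)) := by
  have hx : Integrable x (volume.restrict (Ioo a b)) := (Lp.memLp x).integrable (by norm_num)
  have hx' : Integrable (fun t => P.toEuclideanLin (x t)) (volume.restrict (Ioo a b)) :=
    (LinearMap.toContinuousLinearMap P.toEuclideanLin).integrable_comp hx
  obtain ⟨C, hC⟩ := hc.exists_bound_of_continuous hφ
  exact hx'.bdd_smul C hφ.aestronglyMeasurable (Filter.Eventually.of_forall hC)

/-- The graph of the minimal operator `(x_e)_e ↦ ((P₁ x_e)')_e` on `⨁ H¹₀(a e, b e)`: all pairs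
`(x, y)` of elements of the `L²`-space such that `y_e` is the weak derivative of `P₁ x_e` and
`x_e` vanishes at both endpoints, for every edge `e`. -/
noncomputable def netGraph {E : Type*} {d : ℕ} (P₁ : Matrix (Fin d) (Fin d) ℂ) (a b : E → ℝ) :
    Submodule ℂ (NetL2 d a b × NetL2 d a b) where
  carrier := {p | ∀ e,
    HasWeakDeriv (a e) (b e) (fun t => P₁.toEuclideanLin (p.1 e t)) (p.2 e) ∧
      ∃ u, IsContRep (a e) (b e) (p.1 e) u ∧ u (a e) = 0 ∧ u (b e) = 0}
  zero_mem' := by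
    intro e
    have h0 : ∀ᵐ t ∂(volume.restrict (Ioo (a e) (b e))),
        ((0 : NetL2 d a b) e : ℝ → EuclideanSpace ℂ (Fin d)) t = 0 := by
      filter_upwards [Lp.coeFn_zero (EuclideanSpace ℂ (Fin d)) 2
        (volume.restrict (Ioo (a e) (b e)))] with t ht
      simpa using ht
    refine ⟨fun φ _ _ _ => ?_, 0, ⟨continuousOn_const, h0⟩, rfl, rfl⟩
    rw [integral_eq_zero_of_ae, integral_eq_zero_of_ae, neg_zero]
    · filter_upwards [h0] with t ht
      exact (congrArg (φ t • ·) ht).trans (smul_zero _)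
    · filter_upwards [h0] with t ht
      exact (congrArg (fun v => deriv φ t • P₁.toEuclideanLin v) ht).trans (by simp)
  add_mem' := by
    intro p q hp hq e
    obtain ⟨hp1, u, ⟨hu, hu'⟩, hua, hub⟩ := hp e
    obtain ⟨hq1, v, ⟨hv, hv'⟩, hva, hvb⟩ := hq e
    have h1 := Lp.coeFn_add (p.1 e) (q.1 e)
    have h2 := Lp.coeFn_add (p.2 e) (q.2 e)
    refine ⟨fun φ h h' h'' => ?_, u + v, ⟨hu.add hv, ?_⟩, by simp [hua, hva], by simp [hub, hvb]⟩
    · have hd : Continuous (deriv φ) := h.continuous_deriv (by simp)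
      have e1 := hp1 φ h h' h''
      have e2 := hq1 φ h h' h''
      rw [integral_congr_ae (g := fun t => deriv φ t • P₁.toEuclideanLin (p.1 e t) +
          deriv φ t • P₁.toEuclideanLin (q.1 e t)),
        integral_add (integrable_test_smul_matrix P₁ hd h'.deriv _)
          (integrable_test_smul_matrix P₁ hd h'.deriv _), e1, e2,
        integral_congr_ae (f := fun t => φ t • ((p + q).2 e) t)
          (g := fun t => φ t • (p.2 e) t + φ t • (q.2 e) t),
        integral_add (integrable_test_smul h.continuous h' _)
          (integrable_test_smul h.continuous h' _), neg_add]
      · filter_upwards [h2] with t ht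
        have : ((p + q).2 e) t = (p.2 e) t + (q.2 e) t := ht
        rw [this, smul_add]
      · filter_upwards [h1] with t ht
        have : ((p + q).1 e) t = (p.1 e) t + (q.1 e) t := ht
        simp only [this, map_add, smul_add]
    · filter_upwards [h1, hu', hv'] with t ht h3 h4
      have : ((p + q).1 e) t = (p.1 e) t + (q.1 e) t := ht
      rw [this, h3, h4, Pi.add_apply]
  smul_mem' := by
    intro c p hp e
    obtain ⟨hp1, u, ⟨hu, hu'⟩, hua, hub⟩ := hp e
    have h1 := Lp.coeFn_smul c (p.1 e)
    have h2 := Lp.coeFn_smul c (p.2 e)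
    refine ⟨fun φ h h' h'' => ?_, c • u, ⟨hu.const_smul c, ?_⟩, by simp [hua], by simp [hub]⟩
    · have e1 := hp1 φ h h' h''
      rw [integral_congr_ae (g := fun t => c • (deriv φ t • P₁.toEuclideanLin (p.1 e t))),
        integral_smul, e1,
        integral_congr_ae (f := fun t => φ t • ((c • p).2 e) t)
          (g := fun t => c • (φ t • (p.2 e) t)), integral_smul, smul_neg]
      · filter_upwards [h2] with t ht
        have : ((c • p).2 e) t = c • (p.2 e) t := ht
        rw [this, smul_comm]
      · filter_upwards [h1] with t ht
        have : ((c • p).1 e) t = c • (p.1 e) t := ht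
        simp only [this, map_smul]
        rw [smul_comm]
    · filter_upwards [h1, hu'] with t ht h3
      have : ((c • p).1 e) t = c • (p.1 e) t := ht
      rw [this, h3, Pi.smul_apply]

/-- Weak derivatives are unique, so `netGraph` is the graph of an operator. -/
lemma netGraph_single_valued {E : Type*} {d : ℕ} (P₁ : Matrix (Fin d) (Fin d) ℂ) (a b : E → ℝ)
    (p : NetL2 d a b × NetL2 d a b) (hp : p ∈ netGraph P₁ a b) (h0 : p.1 = 0) : p.2 = 0 := by
  ext1
  funext e
  obtain ⟨h1, -⟩ := hp e
  have hz : ∀ᵐ t ∂(volume.restrict (Ioo (a e) (b e))),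
      (p.1 e : ℝ → EuclideanSpace ℂ (Fin d)) t = 0 := by
    rw [h0]
    filter_upwards [Lp.coeFn_zero (EuclideanSpace ℂ (Fin d)) 2
      (volume.restrict (Ioo (a e) (b e)))] with t ht
    simpa using ht
  have hint : Integrable (p.2 e) (volume.restrict (Ioo (a e) (b e))) :=
    (Lp.memLp (p.2 e)).integrable (by norm_num)
  have key := IsOpen.ae_eq_zero_of_integral_contDiff_smul_eq_zero
    (μ := volume.restrict (Ioo (a e) (b e))) (f := p.2 e) (isOpen_Ioo (a := a e) (b := b e))
    (hint.locallyIntegrable.locallyIntegrableOn _) (fun φ h h' h'' => by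
      have := h1 φ h h' h''
      rw [integral_eq_zero_of_ae] at this
      · exact neg_eq_zero.mp this.symm
      · filter_upwards [hz] with t ht
        simp [ht])
  apply Lp.ext
  filter_upwards [key, ae_restrict_mem measurableSet_Ioo, Lp.coeFn_zero (EuclideanSpace ℂ (Fin d)) 2
    (volume.restrict (Ioo (a e) (b e)))] with t ht ht' ht''
  rw [ht ht']
  simpa using ht''.symm

/-- The operator `A : ⨁ H¹₀(a e, b e) ⊆ ⨁ L²(a e, b e) → ⨁ L²(a e, b e)`,
`(x_e)_e ↦ ((P₁ x_e)')_e`. -/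
noncomputable def netOp {E : Type*} {d : ℕ} (P₁ : Matrix (Fin d) (Fin d) ℂ) (a b : E → ℝ) :
    NetL2 d a b →ₗ.[ℂ] NetL2 d a b :=
  (netGraph P₁ a b).toLinearPMap

lemma netOp_graph {E : Type*} {d : ℕ} (P₁ : Matrix (Fin d) (Fin d) ℂ) (a b : E → ℝ) :
    (netOp P₁ a b).graph = netGraph P₁ a b :=
  Submodule.toLinearPMap_graph_eq _ (netGraph_single_valued P₁ a b)

/-- The operator `Ã`: the same edges, all of them being copies of the unit interval `(0, 1)`. -/
noncomputable abbrev modelOp (E : Type*) {d : ℕ} (P₁ : Matrix (Fin d) (Fin d) ℂ) :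
    NetL2 d (fun _ : E => 0) (fun _ : E => 1) →ₗ.[ℂ] NetL2 d (fun _ : E => 0) (fun _ : E => 1) :=
  netOp P₁ (fun _ : E => 0) (fun _ : E => 1)

/-! ### Maximal dissipative operators -/

section Dissipative

variable {X : Type*} [NormedAddCommGroup X] [InnerProductSpace ℂ X]

def IsDissipative (H : X →ₗ.[ℂ] X) : Prop :=
  ∀ x : H.domain, (inner ℂ (H x) (x : X)).re ≤ 0

def IsMaximalDissipative (H : X →ₗ.[ℂ] X) : Prop :=
  IsDissipative H ∧ ∀ K : X →ₗ.[ℂ] X, IsDissipative K → H ≤ K → K = H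

/-- The set of maximal dissipative operators that extend `B`. -/
def MaxDissExt (B : X →ₗ.[ℂ] X) : Set (X →ₗ.[ℂ] X) :=
  {H | B ≤ H ∧ IsMaximalDissipative H}

/-- `ker (1 - B)` for a partially defined operator `B`, as a subspace of `X`. -/
def kerOneSub (B : X →ₗ.[ℂ] X) : Submodule ℂ X :=
  (LinearMap.ker (B.domain.subtype - B.toFun)).map B.domain.subtype

/-- `ker (1 + B)` for a partially defined operator `B`, as a subspace of `X`. -/
def kerOneAdd (B : X →ₗ.[ℂ] X) : Submodule ℂ X :=
  (LinearMap.ker (B.domain.subtype + B.toFun)).map B.domain.subtype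

end Dissipative

/-! ### Identification of the deficiency spaces of `A` and `Ã` -/

/-- The diagonal of `Δ = diag(Λ, -Θ)`. -/
def signedDiag {np nm : ℕ} (lam : Fin np → Ioi (0 : ℝ)) (theta : Fin nm → Ioi (0 : ℝ)) :
    Fin np ⊕ Fin nm → ℝ :=
  Sum.elim (fun k => (lam k : ℝ)) (fun k => -(theta k : ℝ))

/-- For `σ = ± 1`, `μ ≠ 0` and `ℓ > 0`, this is the norm of `s ↦ exp (-σ s / μ)` in
`L²(0, ℓ)`. -/
noncomputable def expNorm (σ μ ℓ : ℝ) : ℝ :=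
  √(σ * μ / 2 * (1 - Real.exp (-(2 * σ * ℓ / μ))))

/-- The graph of the canonical unitary map `U_σ` (`σ = ± 1`) from `ker (1 + σ (P₁ ·)')` on the
network with edges `(a e, b e)` onto `ker (1 + σ (P₁ ·)')` on the unit length network, where
`P₁ = Sᴴ diag(μ) S`. On each edge and in each coordinate with respect to the
eigenbasis of `P₁`, a multiple of the exponential `t ↦ exp (-σ (t - a e) / μ k)` on `(a e, b e)` is
mapped to the *positive* multiple of equal norm of `t ↦ exp (-σ t / μ k)` on `(0, 1)`. -/
def IsUnitaryCopy {E : Type*} {d : ℕ} {ι : Type*} (S : Matrix ι (Fin d) ℂ) (μ : ι → ℝ)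
    (a b : E → ℝ) (σ : ℝ) (x : NetL2 d a b) (y : NetL2 d (fun _ : E => 0) (fun _ : E => 1)) :
    Prop :=
  ∃ c : E → ι → ℂ, ∀ e,
    (∀ᵐ t ∂(volume.restrict (Ioo (a e) (b e))), ∀ k,
      (S *ᵥ (x e t).ofLp) k = c e k * (Real.exp (-(σ * (t - a e) / μ k)) : ℂ)) ∧
    (∀ᵐ t ∂(volume.restrict (Ioo (0 : ℝ) 1)), ∀ k,
      (S *ᵥ (y e t).ofLp) k =
        (expNorm σ (μ k) (b e - a e) / expNorm σ (μ k) 1 : ℝ) * c e k *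
          (Real.exp (-(σ * t / μ k)) : ℂ))

/-! ### Boundary values on the unit length network -/

/-- `ℂⁿ` with the scalar product `⟨x, diag(w) y⟩`, for positive weights `w`. -/
def WSpace {n : ℕ} (_w : Fin n → Ioi (0 : ℝ)) : Type := Fin n → ℂ

section WSpace

variable {n : ℕ} (w : Fin n → Ioi (0 : ℝ))

instance : AddCommGroup (WSpace w) := inferInstanceAs (AddCommGroup (Fin n → ℂ))

instance : Module ℂ (WSpace w) := inferInstanceAs (Module ℂ (Fin n → ℂ))

@[reducible] noncomputable def WSpace.core : InnerProductSpace.Core ℂ (WSpace w) where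
  inner x y := ∑ k, ((w k : ℝ) : ℂ) * (star (x k) * y k)
  conj_inner_symm x y := by
    simp [map_sum, mul_comm]
  re_inner_nonneg x := by
    rw [map_sum]
    refine Finset.sum_nonneg fun k _ => ?_
    have : ((w k : ℝ) : ℂ) * (star (x k) * x k) = (((w k : ℝ) * ‖x k‖ ^ 2 : ℝ) : ℂ) := by
      simp [Complex.conj_mul']
    rw [this]
    have := (w k).2
    simp only [mem_Ioi] at this
    simp only [RCLike.re_to_complex, Complex.ofReal_re]
    positivity
  add_left x y z := by
    rw [← Finset.sum_add_distrib]
    refine Finset.sum_congr rfl fun k _ => ?_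
    have : (x + y) k = x k + y k := rfl
    rw [this, star_add]
    ring
  smul_left x y r := by
    rw [Finset.mul_sum]
    refine Finset.sum_congr rfl fun k _ => ?_
    have : (r • x) k = r * x k := rfl
    rw [this, star_mul]
    simp only [Complex.star_def]
    ring
  definite x hx := by
    have h1 : ∑ k, (w k : ℝ) * ‖x k‖ ^ 2 = 0 := by
      have : (∑ k, ((w k : ℝ) : ℂ) * (star (x k) * x k)) = ((∑ k, (w k : ℝ) * ‖x k‖ ^ 2 : ℝ) : ℂ) := by
        rw [Complex.ofReal_sum]
        exact Finset.sum_congr rfl fun k _ => by simp [Complex.conj_mul']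
      rw [this] at hx
      exact_mod_cast hx
    have hw : ∀ k, (0 : ℝ) < w k := fun k => (w k).2
    rw [Finset.sum_eq_zero_iff_of_nonneg fun k _ => mul_nonneg (hw k).le (sq_nonneg _)] at h1
    funext k
    have : x k = 0 := by simpa [(hw k).ne'] using h1 k (Finset.mem_univ k)
    exact this

noncomputable instance : NormedAddCommGroup (WSpace w) := (WSpace.core w).toNormedAddCommGroup

noncomputable instance : InnerProductSpace ℂ (WSpace w) :=
  InnerProductSpace.ofCore (WSpace.core w).toCore

lemma WSpace.inner_def (x y : WSpace w) :
    inner ℂ x y = ∑ k, ((w k : ℝ) : ℂ) * (star (x k) * y k) := rfl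

end WSpace

/-- The Hilbert space `⨁_{e ∈ E} ℂ^{n_v} ⊕ ⨁_{e ∈ E} ℂ^{n_w}`, where `ℂ^{n_v}`, `ℂ^{n_w}` carry the
scalar products with weights `v` (values at `0`) and `w` (values at `1`). One has
`G₁ = BdSpace E lam theta` and `G₂ = BdSpace E theta lam`. -/
abbrev BdSpace (E : Type*) {m n : ℕ} (v : Fin m → Ioi (0 : ℝ)) (w : Fin n → Ioi (0 : ℝ)) : Type _ :=
  WithLp 2 (lp (fun _ : E => WSpace v) 2 × lp (fun _ : E => WSpace w) 2)

/-- `g₁ = ((pr₊ (S x_e)(0))_e, (pr₋ (S x_e)(1))_e)` and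
`g₂ = ((pr₋ (S x_e)(0))_e, (pr₊ (S x_e)(1))_e)`, where the point values are those of the continuous
representative of `x_e`. -/
def HasTraces {E : Type*} {d np nm : ℕ} (S : Matrix (Fin np ⊕ Fin nm) (Fin d) ℂ)
    {lam : Fin np → Ioi (0 : ℝ)} {theta : Fin nm → Ioi (0 : ℝ)}
    (x : NetL2 d (fun _ : E => 0) (fun _ : E => 1))
    (g₁ : BdSpace E lam theta) (g₂ : BdSpace E theta lam) : Prop :=
  ∀ e, ∃ u, IsContRep 0 1 (x e) u ∧
    (∀ k, g₁.fst e k = (S *ᵥ (u 0).ofLp) (Sum.inl k)) ∧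
    (∀ k, g₁.snd e k = (S *ᵥ (u 1).ofLp) (Sum.inr k)) ∧
    (∀ k, g₂.fst e k = (S *ᵥ (u 0).ofLp) (Sum.inr k)) ∧
    (∀ k, g₂.snd e k = (S *ᵥ (u 1).ofLp) (Sum.inl k))

/-! ### Partially defined operators and their graphs -/

section Graph

variable {X : Type*} [NormedAddCommGroup X] [InnerProductSpace ℂ X]

/-! The argument rests on boundary pairs (`IsBoundaryPair`). Suppose that every dissipative
extension of `-A` is a restriction of `B`, and that `Re ⟨Bx, x⟩ = c (‖Γ₁ x‖² - ‖Γ₂ x‖²)` with `c >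
0`, where `(Γ₁, Γ₂)` is onto `G₁ × G₂` and vanishes on `D(A)`. A restriction of `B` is then
dissipative exactly when `‖Γ₁ x‖ ≤ ‖Γ₂ x‖` on its domain, so the pairs `(Γ₂ x, Γ₁ x)` form the graph
of a partially defined contraction, and maximality corresponds to this contraction being defined
everywhere. This is the bijection `paramEquiv` between contractions `G₂ → G₁` and maximal
dissipative extensions.

The network operator is densely defined, closed and skew-symmetric, and its adjoint is minus the
maximal operator, without boundary conditions (`mem_netOp_adjoint_graph`); this follows from Green's
identity and the lemma of du Bois-Reymond. For every such operator, `B = A†` and the components of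
von Neumann's decomposition in `ker (1 - A†)` and `ker (1 + A†)` give a boundary pair
(`exists_deficiency_boundaryPair`). Both deficiency spaces have a Hilbert basis of normalized
exponentials indexed by edges and coordinates, whatever the edge lengths, and matching these bases
gives the unitaries `U_σ` (`exists_unitaryCopy`). After composition with them, the extensions on
both networks are parametrized by the same contractions, and `Φ` keeps the parameter.

On the unit network the boundary values give a second boundary pair (`exists_trace_boundaryPair`):
Green's identity expresses the form through the traces, affine functions realize arbitrary traces,
and since all edges are equal, the trace estimate is uniform in the edge, so that traces are square
summable. The contraction `T̃` is the parameter of `Φ H` for this pair. -/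

lemma mem_kerOneSub_iff {B : X →ₗ.[ℂ] X} {x : X} : x ∈ kerOneSub B ↔ (x, x) ∈ B.graph := by
  rw [kerOneSub, Submodule.mem_map, LinearPMap.mem_graph_iff]
  refine exists_congr fun y => ?_
  rw [LinearMap.mem_ker, LinearMap.sub_apply, sub_eq_zero, Submodule.subtype_apply,
    LinearPMap.toFun_eq_coe]
  constructor
  · rintro ⟨h, rfl⟩
    exact ⟨rfl, h.symm⟩
  · rintro ⟨h, h'⟩
    exact ⟨h.trans h'.symm, h⟩

lemma mem_kerOneAdd_iff {B : X →ₗ.[ℂ] X} {x : X} : x ∈ kerOneAdd B ↔ (x, -x) ∈ B.graph := by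
  rw [kerOneAdd, Submodule.mem_map, LinearPMap.mem_graph_iff]
  refine exists_congr fun y => ?_
  rw [LinearMap.mem_ker, LinearMap.add_apply, Submodule.subtype_apply,
    LinearPMap.toFun_eq_coe, add_comm, add_eq_zero_iff_eq_neg]
  constructor
  · rintro ⟨h, rfl⟩
    exact ⟨rfl, h⟩
  · rintro ⟨h, h'⟩
    exact ⟨h'.trans (congrArg Neg.neg h.symm), h⟩

end Graph

/-! ### Extension of partially defined contractions -/

section Contraction

variable {G₁ G₂ : Type*} [NormedAddCommGroup G₁] [InnerProductSpace ℂ G₁] [CompleteSpace G₁]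
  [NormedAddCommGroup G₂] [InnerProductSpace ℂ G₂] [CompleteSpace G₂]

/-- A contraction defined on a subspace of a Hilbert space extends to the whole space. -/
lemma exists_contraction_extension (f : G₂ →ₗ.[ℂ] G₁) (hf : ∀ x, ‖f x‖ ≤ ‖x‖) :
    ∃ T : G₂ →L[ℂ] G₁, ‖T‖ ≤ 1 ∧ ∀ x : f.domain, T x = f x := by
  let K := f.domain.topologicalClosure
  have hK : IsClosed (K : Set G₂) := f.domain.isClosed_topologicalClosure
  have : CompleteSpace K := hK.completeSpace_coe
  let f₀ : f.domain →L[ℂ] G₁ := f.toFun.mkContinuous 1 fun x => by simpa using hf x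
  let i : f.domain →L[ℂ] K :=
    ⟨Submodule.inclusion f.domain.le_topologicalClosure, by
      exact continuous_subtype_val.subtype_mk _⟩
  have hi : ∀ x, ‖x‖ = ‖i x‖ := fun x => rfl
  have hd : DenseRange i := by
    intro x
    rw [Topology.IsInducing.subtypeVal.closure_eq_preimage_closure_image]
    have h : (f.domain : Set G₂) ⊆ Subtype.val '' range i :=
      fun y hy => ⟨i ⟨y, hy⟩, mem_range_self _, rfl⟩
    exact closure_mono h x.2
  have hu : IsUniformInducing i :=
    (AddMonoidHomClass.isometry_of_norm i fun x => (hi x).symm).isUniformInducing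
  let T₀ : K →L[ℂ] G₁ := f₀.extend i
  have hT₀ : ‖T₀‖ ≤ 1 := by
    have := f₀.opNorm_extend_le (e := i) (N := 1) hd (fun x => by simp [hi x])
    refine this.trans ?_
    simpa using f.toFun.mkContinuous_norm_le zero_le_one (fun x => by simpa using hf x)
  -- Extending by zero on the orthogonal complement of the closure does not increase the norm.
  refine ⟨T₀ ∘L K.orthogonalProjectionOnto, ?_, fun x => ?_⟩
  · refine (ContinuousLinearMap.opNorm_comp_le _ _).trans ?_
    exact mul_le_one₀ hT₀ (norm_nonneg _) K.orthogonalProjectionOnto_norm_le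
  · have h1 : K.orthogonalProjectionOnto (x : G₂) = i x :=
      K.orthogonalProjectionOnto_mem_subspace_eq_self (i x)
    rw [ContinuousLinearMap.comp_apply, h1]
    exact f₀.extend_eq hd hu x

end Contraction

/-! ### Boundary pairs -/

section BoundaryPair

variable {X G₁ G₂ : Type*} [NormedAddCommGroup X] [InnerProductSpace ℂ X]
  [NormedAddCommGroup G₁] [InnerProductSpace ℂ G₁]
  [NormedAddCommGroup G₂] [InnerProductSpace ℂ G₂]

/-- The linear maps `Γ₁`, `Γ₂` on the domain of `B` form a boundary pair for the dissipative
extensions of `A₀`. -/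
structure IsBoundaryPair (A₀ B : X →ₗ.[ℂ] X) (Γ₁ : B.domain →ₗ[ℂ] G₁)
    (Γ₂ : B.domain →ₗ[ℂ] G₂) (c : ℝ) : Prop where
  pos : 0 < c
  form : ∀ x, (inner ℂ (B x) (x : X)).re = c * (‖Γ₁ x‖ ^ 2 - ‖Γ₂ x‖ ^ 2)
  surj : ∀ g₁ g₂, ∃ x, Γ₁ x = g₁ ∧ Γ₂ x = g₂
  le : A₀ ≤ B
  map₁ : ∀ x : B.domain, (x : X) ∈ A₀.domain → Γ₁ x = 0
  map₂ : ∀ x : B.domain, (x : X) ∈ A₀.domain → Γ₂ x = 0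
  le_of_dissipative : ∀ H, IsDissipative H → A₀ ≤ H → H ≤ B

/-- The restriction of `B` to the vectors `x` with `T (Γ₂ x) = Γ₁ x`. -/
def boundaryRestrict (B : X →ₗ.[ℂ] X) (Γ₁ : B.domain →ₗ[ℂ] G₁) (Γ₂ : B.domain →ₗ[ℂ] G₂)
    (T : G₂ →L[ℂ] G₁) : X →ₗ.[ℂ] X :=
  B.domRestrict ((LinearMap.ker (T.toLinearMap ∘ₗ Γ₂ - Γ₁)).map B.domain.subtype)

variable {A₀ B : X →ₗ.[ℂ] X} {Γ₁ : B.domain →ₗ[ℂ] G₁} {Γ₂ : B.domain →ₗ[ℂ] G₂} {c : ℝ}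

lemma mem_boundaryRestrict {T : G₂ →L[ℂ] G₁} {x : X} :
    x ∈ (boundaryRestrict B Γ₁ Γ₂ T).domain ↔
      ∃ h : x ∈ B.domain, T (Γ₂ ⟨x, h⟩) = Γ₁ ⟨x, h⟩ := by
  rw [boundaryRestrict, LinearPMap.domRestrict_domain, Submodule.mem_inf, Submodule.mem_map]
  constructor
  · rintro ⟨⟨y, hy, rfl⟩, h⟩
    exact ⟨h, by simpa [sub_eq_zero] using hy⟩
  · rintro ⟨h, h'⟩
    exact ⟨⟨⟨x, h⟩, by simpa [sub_eq_zero] using h', rfl⟩, h⟩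

lemma boundaryRestrict_le (T : G₂ →L[ℂ] G₁) : boundaryRestrict B Γ₁ Γ₂ T ≤ B :=
  LinearPMap.domRestrict_le

namespace IsBoundaryPair

variable (hΓ : IsBoundaryPair A₀ B Γ₁ Γ₂ c)
include hΓ

lemma dissipative_of_le {H : X →ₗ.[ℂ] X} (hH : H ≤ B)
    (h : ∀ x : B.domain, (x : X) ∈ H.domain → ‖Γ₁ x‖ ≤ ‖Γ₂ x‖) : IsDissipative H := by
  intro x
  have hx : H x = B ⟨x, hH.1 x.2⟩ := hH.2 rfl
  rw [hx, hΓ.form ⟨x, hH.1 x.2⟩]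
  have := pow_le_pow_left₀ (norm_nonneg _) (h ⟨x, hH.1 x.2⟩ x.2) 2
  exact mul_nonpos_of_nonneg_of_nonpos hΓ.pos.le (by linarith)

lemma norm_le_of_dissipative {H : X →ₗ.[ℂ] X} (hH : H ≤ B) (hd : IsDissipative H)
    (x : B.domain) (hx : (x : X) ∈ H.domain) : ‖Γ₁ x‖ ≤ ‖Γ₂ x‖ := by
  have h1 : H ⟨x, hx⟩ = B x := hH.2 rfl
  have h2 := hd ⟨x, hx⟩
  rw [h1, hΓ.form x] at h2
  have h3 := nonpos_of_mul_nonpos_right h2 hΓ.pos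
  exact le_of_sq_le_sq (by linarith) (norm_nonneg _)

/-- Maximality: for `x` in a larger dissipative `K`, surjectivity gives `y` with boundary values `(T
(Γ₂ x), Γ₂ x)`, which lies in the restricted domain. Then `x - y ∈ D(K)` has `Γ₂ (x - y) = 0`, so
dissipativity forces `Γ₁ (x - y) = 0`, that is `Γ₁ x = T (Γ₂ x)`. -/
lemma boundaryRestrict_mem {T : G₂ →L[ℂ] G₁} (hT : ‖T‖ ≤ 1) :
    boundaryRestrict B Γ₁ Γ₂ T ∈ MaxDissExt A₀ := by
  have hle : A₀ ≤ boundaryRestrict B Γ₁ Γ₂ T := by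
    have : A₀.domain ≤ (boundaryRestrict B Γ₁ Γ₂ T).domain := fun x hx =>
      mem_boundaryRestrict.2 ⟨hΓ.le.1 hx, by
        rw [hΓ.map₁ ⟨x, hΓ.le.1 hx⟩ hx, hΓ.map₂ ⟨x, hΓ.le.1 hx⟩ hx, map_zero]⟩
    refine ⟨this, fun x y hxy => ?_⟩
    have h1 : A₀ x = B ⟨x, hΓ.le.1 x.2⟩ := hΓ.le.2 rfl
    have h2 : boundaryRestrict B Γ₁ Γ₂ T y = B ⟨x, hΓ.le.1 x.2⟩ :=
      (boundaryRestrict_le T).2 hxy.symm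
    rw [h1, h2]
  refine ⟨hle, hΓ.dissipative_of_le (boundaryRestrict_le T) fun x hx => ?_, fun K hK hHK => ?_⟩
  · obtain ⟨_, h⟩ := mem_boundaryRestrict.1 hx
    rw [← h]
    exact T.le_of_opNorm_le hT _ |>.trans (by simp)
  · have hKB := hΓ.le_of_dissipative K hK (hle.trans hHK)
    refine (LinearPMap.eq_of_le_of_domain_eq hHK (le_antisymm hHK.1 fun x hx => ?_)).symm
    let x' : B.domain := ⟨x, hKB.1 hx⟩
    obtain ⟨y, hy₁, hy₂⟩ := hΓ.surj (T (Γ₂ x')) (Γ₂ x')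
    have hy : (y : X) ∈ K.domain := hHK.1 (mem_boundaryRestrict.2 ⟨y.2, by
      change T (Γ₂ y) = Γ₁ y
      rw [hy₁, hy₂]⟩)
    have := hΓ.norm_le_of_dissipative hKB hK (x' - y) (K.domain.sub_mem hx hy)
    rw [map_sub, map_sub, hy₁, hy₂, sub_self, norm_zero, norm_le_zero_iff, sub_eq_zero] at this
    exact mem_boundaryRestrict.2 ⟨x'.2, this.symm⟩

/-- By dissipativity the pairs `(Γ₂ x, Γ₁ x)` with `x ∈ D(H)` form the graph of a contraction on a
subspace of `G₂`. Any contractive extension `T` of it defines a dissipative operator containing `H`,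
and maximality of `H` gives equality. -/
lemma exists_eq_boundaryRestrict [CompleteSpace G₁] [CompleteSpace G₂] {H : X →ₗ.[ℂ] X}
    (hH : H ∈ MaxDissExt A₀) :
    ∃ T : G₂ →L[ℂ] G₁, ‖T‖ ≤ 1 ∧ boundaryRestrict B Γ₁ Γ₂ T = H := by
  have hHB := hΓ.le_of_dissipative H hH.2.1 hH.1
  let V : Submodule ℂ (G₂ × G₁) := (H.domain.comap B.domain.subtype).map (Γ₂.prod Γ₁)
  have hV : ∀ p ∈ V, ‖p.2‖ ≤ ‖p.1‖ := by
    rintro _ ⟨x, hx, rfl⟩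
    exact hΓ.norm_le_of_dissipative hHB hH.2.1 x hx
  have hV' : ∀ p ∈ V, p.1 = 0 → p.2 = 0 := fun p hp h0 => by
    simpa [h0] using hV p hp
  have hg := Submodule.toLinearPMap_graph_eq V hV'
  obtain ⟨T, hT, hT'⟩ := exists_contraction_extension V.toLinearPMap fun x => by
    exact hV _ (hg.le (LinearPMap.mem_graph _ x))
  refine ⟨T, hT, ?_⟩
  have hmax := hΓ.boundaryRestrict_mem hT
  refine hH.2.2 _ hmax.2.1 ?_
  have hdom : H.domain ≤ (boundaryRestrict B Γ₁ Γ₂ T).domain := fun x hx => by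
    refine mem_boundaryRestrict.2 ⟨hHB.1 hx, ?_⟩
    have : (Γ₂ ⟨x, hHB.1 hx⟩, Γ₁ ⟨x, hHB.1 hx⟩) ∈ V.toLinearPMap.graph := by
      rw [hg]
      exact ⟨⟨x, hHB.1 hx⟩, hx, rfl⟩
    obtain ⟨y, hy, hy'⟩ := LinearPMap.mem_graph_iff _ |>.1 this
    have h := hT' y
    rw [hy', hy] at h
    exact h
  refine ⟨hdom, fun x y hxy => ?_⟩
  have h1 : H x = B ⟨x, hHB.1 x.2⟩ := hHB.2 rfl
  have h2 : boundaryRestrict B Γ₁ Γ₂ T y = B ⟨x, hHB.1 x.2⟩ := (boundaryRestrict_le T).2 hxy.symm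
  rw [h1, h2]

/-- Surjectivity realizes each pair `(T g, g)` as boundary values, so an inclusion of domains
already determines the parameter. -/
lemma parameter_unique {T T' : G₂ →L[ℂ] G₁}
    (h : (boundaryRestrict B Γ₁ Γ₂ T).domain ≤ (boundaryRestrict B Γ₁ Γ₂ T').domain) :
    T = T' := by
  ext g
  obtain ⟨x, hx₁, hx₂⟩ := hΓ.surj (T g) g
  obtain ⟨_, h'⟩ := mem_boundaryRestrict.1 (h (mem_boundaryRestrict.2 ⟨x.2, by
    change T (Γ₂ x) = Γ₁ x
    rw [hx₁, hx₂]⟩))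
  change T' (Γ₂ x) = Γ₁ x at h'
  rw [hx₁, hx₂] at h'
  exact h'.symm

/-- Maximal dissipative extensions are parametrized by contractions. -/
noncomputable def paramEquiv [CompleteSpace G₁] [CompleteSpace G₂] :
    {T : G₂ →L[ℂ] G₁ // ‖T‖ ≤ 1} ≃ MaxDissExt A₀ :=
  Equiv.ofBijective (fun T => ⟨boundaryRestrict B Γ₁ Γ₂ T.1, hΓ.boundaryRestrict_mem T.2⟩) <| by
    refine ⟨fun T T' h => Subtype.ext (hΓ.parameter_unique ?_), fun H => ?_⟩
    · exact (congrArg LinearPMap.domain (congrArg Subtype.val h)).le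
    · obtain ⟨T, hT, h⟩ := hΓ.exists_eq_boundaryRestrict H.2
      exact ⟨⟨T, hT⟩, Subtype.ext h⟩

/-- Boundary pairs may be composed with unitary maps. -/
lemma comp {G₁' G₂' : Type*} [NormedAddCommGroup G₁'] [InnerProductSpace ℂ G₁']
    [NormedAddCommGroup G₂'] [InnerProductSpace ℂ G₂'] (U₁ : G₁ ≃ₗᵢ[ℂ] G₁') (U₂ : G₂ ≃ₗᵢ[ℂ] G₂') :
    IsBoundaryPair A₀ B (U₁.toLinearEquiv.toLinearMap ∘ₗ Γ₁)
      (U₂.toLinearEquiv.toLinearMap ∘ₗ Γ₂) c where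
  pos := hΓ.pos
  form x := by simpa using hΓ.form x
  surj g₁ g₂ := by
    obtain ⟨x, h₁, h₂⟩ := hΓ.surj (U₁.symm g₁) (U₂.symm g₂)
    exact ⟨x, by simp [h₁], by simp [h₂]⟩
  le := hΓ.le
  map₁ x hx := by simp [hΓ.map₁ x hx]
  map₂ x hx := by simp [hΓ.map₂ x hx]
  le_of_dissipative := hΓ.le_of_dissipative

end IsBoundaryPair

end BoundaryPair

/-! ### The boundary pair given by the deficiency spaces -/

section Deficiency

open scoped LinearPMap InnerProductSpace

variable {X : Type*} [NormedAddCommGroup X] [InnerProductSpace ℂ X] [CompleteSpace X]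
  {A : X →ₗ.[ℂ] X}

lemma mem_adjoint_graph_iff (hA : Dense (A.domain : Set X)) {x z : X} :
    (x, z) ∈ A†.graph ↔ ∀ u v, (u, v) ∈ A.graph → ⟪v, x⟫_ℂ = ⟪u, z⟫_ℂ := by
  rw [LinearPMap.adjoint_graph_eq_graph_adjoint hA, Submodule.mem_adjoint_iff]
  simp only [sub_eq_zero]

lemma isClosed_adjoint_ker (hA : Dense (A.domain : Set X)) (c : ℂ) :
    IsClosed {x : X | (x, c • x) ∈ A†.graph} :=
  (LinearPMap.adjoint_isClosed hA).preimage
    (continuous_id.prodMk (continuous_const.smul continuous_id))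

lemma isClosed_kerOneSub_adjoint (hA : Dense (A.domain : Set X)) :
    IsClosed (kerOneSub (A†) : Set X) := by
  convert isClosed_adjoint_ker hA 1 using 1
  ext x
  simp [mem_kerOneSub_iff]

lemma isClosed_kerOneAdd_adjoint (hA : Dense (A.domain : Set X)) :
    IsClosed (kerOneAdd (A†) : Set X) := by
  convert isClosed_adjoint_ker hA (-1) using 1
  ext x
  simp [mem_kerOneAdd_iff]

/-- A dissipative extension of `-A`, where `A` is skew-symmetric, is a restriction of `A†`. -/
lemma le_adjoint_of_dissipative (hA : Dense (A.domain : Set X)) (hskew : -A ≤ A†)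
    {H : X →ₗ.[ℂ] X} (hH : IsDissipative H) (hle : -A ≤ H) : H ≤ A† := by
  have hform : ∀ (x : H.domain) (y : A.domain), (⟪H x, (y : X)⟫_ℂ - ⟪(x : X), A y⟫_ℂ).re = 0 := by
    intro x y
    have hy : H ⟨y, hle.1 y.2⟩ = -A y := (hle.2 (x := y) (y := ⟨y, hle.1 y.2⟩) rfl).symm
    have hyy : (⟪A y, (y : X)⟫_ℂ).re = 0 := by
      have h1 : ((y : X), -A y) ∈ A†.graph :=
        LinearPMap.le_graph_of_le hskew (LinearPMap.mem_graph (-A) y)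
      have h2 := (mem_adjoint_graph_iff hA).1 h1 _ _ (LinearPMap.mem_graph A y)
      have h3 : (⟪(y : X), A y⟫_ℂ).re = (⟪A y, (y : X)⟫_ℂ).re := inner_re_symm (𝕜 := ℂ) _ _
      have h4 := congrArg Complex.re h2
      rw [inner_neg_right, Complex.neg_re, h3] at h4
      linarith
    by_contra hne
    set r := (⟪H x, (y : X)⟫_ℂ - ⟪(x : X), A y⟫_ℂ).re with hr
    set q := (⟪H x, (x : X)⟫_ℂ).re
    -- Dissipativity is tested at `x + t y`. The term quadratic in `t` vanishes because `Re ⟨A y, y⟩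
    -- = 0`, so an affine function of `t` is bounded above and its slope `r` must be zero.
    have key : ∀ t : ℝ, q + t * r ≤ 0 := by
      intro t
      have h := hH (x + (t : ℂ) • ⟨y, hle.1 y.2⟩)
      rw [LinearPMap.map_add, LinearPMap.map_smul, hy] at h
      have h3 : (⟪A y, (x : X)⟫_ℂ).re = (⟪(x : X), A y⟫_ℂ).re := inner_re_symm (𝕜 := ℂ) _ _
      simp only [Submodule.coe_add, Submodule.coe_smul, inner_add_left, inner_add_right,
        inner_smul_left, inner_smul_right, inner_neg_left, Complex.conj_ofReal, Complex.add_re,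
        Complex.re_ofReal_mul, Complex.neg_re, hyy, h3] at h
      rw [hr, Complex.sub_re]
      linarith
    -- This `t` makes the affine function equal to `1`.
    have := key ((1 - q) / r)
    rw [div_mul_cancel₀ _ hne] at this
    linarith
  have hform' : ∀ (x : H.domain) (y : A.domain), ⟪H x, (y : X)⟫_ℂ = ⟪(x : X), A y⟫_ℂ := by
    intro x y
    rw [← sub_eq_zero]
    refine Complex.ext (hform x y) ?_
    -- Replacing `y` by `i y` turns the real part into the imaginary part.
    have h := hform x (Complex.I • y)
    rw [LinearPMap.map_smul, Submodule.coe_smul, inner_smul_right, inner_smul_right, ← mul_sub,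
      Complex.I_mul_re, neg_eq_zero] at h
    exact h
  exact LinearPMap.IsFormalAdjoint.le_adjoint hA fun x y =>
    (by rw [← inner_conj_symm, ← hform' y x, inner_conj_symm] : ⟪A x, (y : X)⟫_ℂ = ⟪(x : X), H y⟫_ℂ)

/-- Von Neumann's decomposition of the domain of the adjoint of a closed skew-symmetric operator. -/
lemma exists_deficiency_decomposition (hA : Dense (A.domain : Set X)) (hskew : -A ≤ A†)
    (hcl : A.IsClosed) {x z : X} (hx : (x, z) ∈ A†.graph) :
    ∃ x₀ y₀, (x₀, y₀) ∈ A.graph ∧ ∃ x₁ ∈ kerOneSub (A†), ∃ x₂ ∈ kerOneAdd (A†),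
      x = x₀ + x₁ + x₂ := by
  -- The graph of `-A`, a closed subspace of the Hilbert space `X × X`. Projecting `(x, z)` onto it
  -- gives the part in `D(A)`, and the orthogonal remainder gives the deficiency vectors.
  let K : Submodule ℂ (WithLp 2 (X × X)) :=
    (-A).graph.map (WithLp.linearEquiv 2 ℂ (X × X)).symm.toLinearMap
  have hmem : ∀ u v, WithLp.toLp 2 (u, v) ∈ K ↔ (u, -v) ∈ A.graph := by
    intro u v
    constructor
    · rintro ⟨p, hp, hp'⟩
      have : p = (u, v) := congrArg WithLp.ofLp hp'
      subst this
      obtain ⟨y, hy, hy'⟩ := (LinearPMap.mem_graph_iff _).1 hp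
      refine (LinearPMap.mem_graph_iff _).2 ⟨y, hy, ?_⟩
      have : -A y = v := hy'
      simp [← this]
    · intro h
      obtain ⟨y, hy, hy'⟩ := (LinearPMap.mem_graph_iff _).1 h
      refine ⟨(u, v), (LinearPMap.mem_graph_iff _).2 ⟨y, hy, ?_⟩, rfl⟩
      change -A y = v
      rw [hy']
      simp
  have hKc : IsClosed (K : Set (WithLp 2 (X × X))) := by
    have : (K : Set (WithLp 2 (X × X))) = {p | (p.fst, -p.snd) ∈ A.graph} := by
      ext p
      exact hmem p.fst p.snd
    rw [this]
    refine hcl.preimage (Continuous.prodMk ?_ ?_)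
    · exact (WithLp.prod_continuous_ofLp 2 X X).fst
    · exact (WithLp.prod_continuous_ofLp 2 X X).snd.neg
  have : CompleteSpace K := hKc.completeSpace_coe
  obtain ⟨k, hk, r, hr, hkr⟩ := K.exists_add_mem_mem_orthogonal (WithLp.toLp 2 (x, z))
  have hkA : (k.fst, -k.snd) ∈ A.graph := (hmem k.fst k.snd).1 hk
  have hk' : (k.fst, k.snd) ∈ A†.graph := by
    have := LinearPMap.le_graph_of_le hskew (x := (k.fst, k.snd))
    apply this
    obtain ⟨y, hy, hy'⟩ := (LinearPMap.mem_graph_iff _).1 hkA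
    refine (LinearPMap.mem_graph_iff _).2 ⟨y, hy, ?_⟩
    change -A y = _
    rw [hy']
    simp
  have hx1 : x = k.fst + r.fst := congrArg WithLp.fst hkr
  have hz1 : z = k.snd + r.snd := congrArg WithLp.snd hkr
  have hrs : (r.fst, r.snd) ∈ A†.graph := by
    have := A†.graph.sub_mem hx hk'
    rw [hx1, hz1] at this
    simpa using this
  -- Orthogonality of `r` to the graph of `-A` says that `A†` maps `r.snd` to `r.fst`. By `hrs` it
  -- also maps `r.fst` to `r.snd`, so half the sum and half the difference are eigenvectors for `1`
  -- and `-1`.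
  have hsr : (r.snd, r.fst) ∈ A†.graph := by
    rw [mem_adjoint_graph_iff hA]
    intro u v huv
    have h1 : WithLp.toLp 2 (u, -v) ∈ K := (hmem _ _).2 (by simpa using huv)
    have h2 := (K.mem_orthogonal r).1 hr _ h1
    rw [WithLp.prod_inner_apply] at h2
    change ⟪u, r.fst⟫_ℂ + ⟪-v, r.snd⟫_ℂ = 0 at h2
    rw [inner_neg_left, ← sub_eq_add_neg, sub_eq_zero] at h2
    exact h2.symm
  refine ⟨k.fst, _, hkA, (2⁻¹ : ℂ) • (r.fst + r.snd), ?_, (2⁻¹ : ℂ) • (r.fst - r.snd), ?_, ?_⟩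
  · rw [mem_kerOneSub_iff]
    have := A†.graph.smul_mem (2⁻¹ : ℂ) (A†.graph.add_mem hrs hsr)
    simpa [add_comm] using this
  · rw [mem_kerOneAdd_iff]
    have := A†.graph.smul_mem (2⁻¹ : ℂ) (A†.graph.sub_mem hrs hsr)
    rwa [Prod.mk_sub_mk, Prod.smul_mk, ← neg_sub r.fst, smul_neg] at this
  · rw [hx1, add_assoc, ← smul_add]
    congr 1
    rw [show r.fst + r.snd + (r.fst - r.snd) = (2 : ℂ) • r.fst by rw [two_smul]; abel, smul_smul]
    norm_num

/-- The boundary pair of a closed skew-symmetric operator given by Von Neumann's decomposition. -/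
lemma exists_deficiency_boundaryPair (hA : Dense (A.domain : Set X)) (hskew : -A ≤ A†)
    (hcl : A.IsClosed) :
    ∃ (Γ₁ : A†.domain →ₗ[ℂ] kerOneSub (A†)) (Γ₂ : A†.domain →ₗ[ℂ] kerOneAdd (A†)),
      IsBoundaryPair (-A) (A†) Γ₁ Γ₂ 1 ∧
        ∀ (x : A†.domain) (x₀ : A.domain) (x₁ : kerOneSub (A†)) (x₂ : kerOneAdd (A†)),
          (x : X) = x₀ + x₁ + x₂ → Γ₁ x = x₁ ∧ Γ₂ x = x₂ := by
  have : CompleteSpace (kerOneSub (A†)) := (isClosed_kerOneSub_adjoint hA).completeSpace_coe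
  have : CompleteSpace (kerOneAdd (A†)) := (isClosed_kerOneAdd_adjoint hA).completeSpace_coe
  -- For `x = x₀ + x₁ + x₂` one has `x + A† x = 2 x₁ + (x₀ - A x₀)` and `x - A† x = 2 x₂ + (x₀ + A
  -- x₀)`. The brackets are orthogonal to the respective kernels, so projecting and halving gives
  -- formulas that are visibly linear and independent of the decomposition.
  let Γ₁ : A†.domain →ₗ[ℂ] kerOneSub (A†) :=
    (2⁻¹ : ℂ) • ((kerOneSub (A†)).orthogonalProjectionOnto.toLinearMap ∘ₗ
      (A†.domain.subtype + A†.toFun))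
  let Γ₂ : A†.domain →ₗ[ℂ] kerOneAdd (A†) :=
    (2⁻¹ : ℂ) • ((kerOneAdd (A†)).orthogonalProjectionOnto.toLinearMap ∘ₗ
      (A†.domain.subtype - A†.toFun))
  have hgraph : ∀ (x : A†.domain) (x₀ : A.domain) (x₁ : kerOneSub (A†)) (x₂ : kerOneAdd (A†)),
      (x : X) = x₀ + x₁ + x₂ → A† x = -A x₀ + x₁ - x₂ := by
    intro x x₀ x₁ x₂ hx
    have h0 : ((x₀ : X), -A x₀) ∈ A†.graph :=
      LinearPMap.le_graph_of_le hskew (LinearPMap.mem_graph (-A) x₀)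
    have h := A†.graph.add_mem (A†.graph.add_mem h0 (mem_kerOneSub_iff.1 x₁.2))
      (mem_kerOneAdd_iff.1 x₂.2)
    rw [Prod.mk_add_mk, Prod.mk_add_mk, ← hx, ← sub_eq_add_neg] at h
    exact A†.mem_graph_snd_inj (LinearPMap.mem_graph _ x) h rfl
  have hdec : ∀ (x : A†.domain) (x₀ : A.domain) (x₁ : kerOneSub (A†)) (x₂ : kerOneAdd (A†)),
      (x : X) = x₀ + x₁ + x₂ → Γ₁ x = x₁ ∧ Γ₂ x = x₂ := by
    intro x x₀ x₁ x₂ hx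
    have hAx := hgraph x x₀ x₁ x₂ hx
    have h0 := LinearPMap.mem_graph A x₀
    constructor
    · have h1 : (x₀ : X) - A x₀ ∈ (kerOneSub (A†))ᗮ := by
        rw [Submodule.mem_orthogonal']
        intro y hy
        have := (mem_adjoint_graph_iff hA).1 (mem_kerOneSub_iff.1 hy) _ _ h0
        rw [inner_sub_left, this, sub_self]
      have h2 : (x : X) + A† x = ((2 : ℂ) • x₁ : kerOneSub (A†)) + ((x₀ : X) - A x₀) := by
        rw [hAx, hx, Submodule.coe_smul, two_smul]
        abel
      change (2⁻¹ : ℂ) • (kerOneSub (A†)).orthogonalProjectionOnto ((x : X) + A† x) = x₁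
      rw [h2, map_add, Submodule.orthogonalProjectionOnto_mem_subspace_eq_self,
        Submodule.orthogonalProjectionOnto_apply_of_mem_orthogonal h1, add_zero, smul_smul]
      norm_num
    · have h1 : (x₀ : X) + A x₀ ∈ (kerOneAdd (A†))ᗮ := by
        rw [Submodule.mem_orthogonal']
        intro y hy
        have := (mem_adjoint_graph_iff hA).1 (mem_kerOneAdd_iff.1 hy) _ _ h0
        rw [inner_add_left, this, inner_neg_right, add_neg_cancel]
      have h2 : (x : X) - A† x = ((2 : ℂ) • x₂ : kerOneAdd (A†)) + ((x₀ : X) + A x₀) := by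
        rw [hAx, hx, Submodule.coe_smul, two_smul]
        abel
      change (2⁻¹ : ℂ) • (kerOneAdd (A†)).orthogonalProjectionOnto ((x : X) - A† x) = x₂
      rw [h2, map_add, Submodule.orthogonalProjectionOnto_mem_subspace_eq_self,
        Submodule.orthogonalProjectionOnto_apply_of_mem_orthogonal h1, add_zero, smul_smul]
      norm_num
  refine ⟨Γ₁, Γ₂, ⟨one_pos, fun x => ?_, fun g₁ g₂ => ?_, hskew, fun x hx => ?_, fun x hx => ?_,
    fun H => le_adjoint_of_dissipative hA hskew⟩, hdec⟩
  · obtain ⟨x₀, y₀, h0, x₁, hx₁, x₂, hx₂, hx⟩ :=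
      exists_deficiency_decomposition hA hskew hcl (LinearPMap.mem_graph _ x)
    obtain ⟨z, rfl, rfl⟩ := (LinearPMap.mem_graph_iff _).1 h0
    obtain ⟨e₁, e₂⟩ := hdec x z ⟨x₁, hx₁⟩ ⟨x₂, hx₂⟩ hx
    have hAx := hgraph x z ⟨x₁, hx₁⟩ ⟨x₂, hx₂⟩ hx
    have k0 : ((z : X), -A z) ∈ A†.graph :=
      LinearPMap.le_graph_of_le hskew (LinearPMap.mem_graph (-A) z)
    -- The adjoint relations cancel all terms containing `z`, and those between `x₁` and `x₂` cancel
    -- by symmetry of the real part; `‖x₁‖² - ‖x₂‖²` remains.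
    have m0 := congrArg Complex.re ((mem_adjoint_graph_iff hA).1 k0 _ _ h0)
    have m1 := congrArg Complex.re ((mem_adjoint_graph_iff hA).1 (mem_kerOneSub_iff.1 hx₁) _ _ h0)
    have m2 := congrArg Complex.re ((mem_adjoint_graph_iff hA).1 (mem_kerOneAdd_iff.1 hx₂) _ _ h0)
    have s0 : (⟪(z : X), A z⟫_ℂ).re = (⟪A z, (z : X)⟫_ℂ).re := inner_re_symm (𝕜 := ℂ) _ _
    have s1 : (⟪x₁, (z : X)⟫_ℂ).re = (⟪(z : X), x₁⟫_ℂ).re := inner_re_symm (𝕜 := ℂ) _ _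
    have s2 : (⟪x₂, (z : X)⟫_ℂ).re = (⟪(z : X), x₂⟫_ℂ).re := inner_re_symm (𝕜 := ℂ) _ _
    have s3 : (⟪x₂, x₁⟫_ℂ).re = (⟪x₁, x₂⟫_ℂ).re := inner_re_symm (𝕜 := ℂ) _ _
    have n1 : (⟪x₁, x₁⟫_ℂ).re = ‖x₁‖ ^ 2 := inner_self_eq_norm_sq (𝕜 := ℂ) x₁
    have n2 : (⟪x₂, x₂⟫_ℂ).re = ‖x₂‖ ^ 2 := inner_self_eq_norm_sq (𝕜 := ℂ) x₂
    rw [e₁, e₂, hAx, hx]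
    simp only [inner_add_left, inner_add_right, inner_sub_left, inner_neg_left, inner_neg_right,
      Complex.add_re, Complex.sub_re, Complex.neg_re, Submodule.coe_norm] at m0 m1 m2 ⊢
    linarith
  · have h := A†.graph.add_mem (mem_kerOneSub_iff.1 g₁.2) (mem_kerOneAdd_iff.1 g₂.2)
    exact ⟨⟨_, LinearPMap.mem_domain_of_mem_graph h⟩, hdec _ 0 g₁ g₂ (by simp)⟩
  · exact (hdec x ⟨x, hx⟩ 0 0 (by simp)).1
  · exact (hdec x ⟨x, hx⟩ 0 0 (by simp)).2

end Deficiency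

/-! ### Integration by parts for primitives of integrable functions -/

section Primitive

variable {V W G : Type*} [NormedAddCommGroup V] [NormedSpace ℝ V]
  [NormedAddCommGroup W] [NormedSpace ℝ W]
  [NormedAddCommGroup G] [NormedSpace ℝ G] {a b : ℝ}

/-- `u` is a primitive of `f` on `[a, b]`. -/
def IsPrimitiveOn (a b : ℝ) (u f : ℝ → V) : Prop :=
  ∀ t ∈ Icc a b, u t = u a + ∫ s in a..t, f s

lemma IsPrimitiveOn.continuousOn {u f : ℝ → V} (h : IsPrimitiveOn a b u f)
    (hf : IntegrableOn f (Ioo a b)) : ContinuousOn u (Icc a b) := by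
  rcases le_or_gt a b with hab | hab
  · have : IntegrableOn f (uIcc a b) := by
      rwa [uIcc_of_le hab, integrableOn_Icc_iff_integrableOn_Ioo]
    have := intervalIntegral.continuousOn_primitive_interval this
    rw [uIcc_of_le hab] at this
    exact (continuousOn_const.add this).congr h
  · simp [Icc_eq_empty hab.not_ge]

lemma isPrimitiveOn_of_hasDerivAt [CompleteSpace V] {u f : ℝ → V} (hf : Continuous f)
    (h : ∀ t, HasDerivAt u (f t) t) : IsPrimitiveOn a b u f := fun t _ => by
  rw [intervalIntegral.integral_eq_sub_of_hasDerivAt (fun s _ => h s)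
    (hf.intervalIntegrable _ _), add_sub_cancel]

lemma integrableOn_bilin (B : V →L[ℝ] W →L[ℝ] G) {f : ℝ → V} {u : ℝ → W}
    (hf : IntegrableOn f (Ioo a b)) (hu : ContinuousOn u (Icc a b)) :
    IntegrableOn (fun t => B (f t) (u t)) (Ioo a b) := by
  obtain ⟨C, hC⟩ := isCompact_Icc.exists_bound_of_continuousOn hu
  have hu' : AEStronglyMeasurable u (volume.restrict (Ioo a b)) :=
    (hu.mono Ioo_subset_Icc_self).aestronglyMeasurable measurableSet_Ioo
  refine (hf.norm.const_mul (‖B‖ * C)).mono' (B.aestronglyMeasurable_comp₂ hf.1 hu') ?_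
  filter_upwards [ae_restrict_mem measurableSet_Ioo] with t ht
  calc ‖B (f t) (u t)‖ ≤ ‖B‖ * ‖f t‖ * ‖u t‖ := B.le_opNorm₂ _ _
    _ ≤ ‖B‖ * ‖f t‖ * C := by
      gcongr
      exact hC t (Ioo_subset_Icc_self ht)
    _ = ‖B‖ * C * ‖f t‖ := by ring

variable [CompleteSpace V] [CompleteSpace W] [CompleteSpace G]

/-- Fubini for `B (f t) (g s)` on a square cut along its diagonal: each triangle gives one of the
two terms on the left. Only integrability is needed, which allows primitives of `L²` functions. -/
lemma integral_bilin_primitive (B : V →L[ℝ] W →L[ℝ] G) {f : ℝ → V} {g : ℝ → W}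
    (hf : IntegrableOn f (Ioc a b)) (hg : IntegrableOn g (Ioc a b)) :
    (∫ t in Ioc a b, B (f t) (∫ s in Ioc a t, g s)) +
      ∫ t in Ioc a b, B (∫ s in Ioc a t, f s) (g t) =
    B (∫ t in Ioc a b, f t) (∫ t in Ioc a b, g t) := by
  set μ := volume.restrict (Ioc a b) with hμ
  set h : ℝ × ℝ → G := fun p => B (f p.1) (g p.2) with hh
  have hI : Integrable h (μ.prod μ) :=
    Integrable.op_fst_snd (op := fun x y => B x y) B.continuous₂ ⟨‖B‖, B.le_opNorm₂⟩ hf hg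
  have hD : MeasurableSet {p : ℝ × ℝ | p.2 ≤ p.1} := measurableSet_le measurable_snd measurable_fst
  have hr1 : ∀ t ∈ Ioc a b, μ.restrict (Iic t) = volume.restrict (Ioc a t) := by
    intro t ht
    rw [hμ, Measure.restrict_restrict measurableSet_Iic, inter_comm, Ioc_inter_Iic, min_eq_right ht.2]
  -- The complementary triangle has a strict inequality, which changes only a null set.
  have hr2 : ∀ t ∈ Ioc a b, μ.restrict (Iio t) = volume.restrict (Ioc a t) := by
    intro t ht
    rw [← hr1 t ht]
    exact Measure.restrict_congr_set Iio_ae_eq_Iic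
  have e1 : ∫ p in {p : ℝ × ℝ | p.2 ≤ p.1}, h p ∂(μ.prod μ) =
      ∫ t in Ioc a b, B (f t) (∫ s in Ioc a t, g s) := by
    rw [← integral_indicator hD, integral_prod _ (hI.indicator hD)]
    refine setIntegral_congr_fun measurableSet_Ioc fun t ht => ?_
    have : (fun s => {p : ℝ × ℝ | p.2 ≤ p.1}.indicator h (t, s)) =
        (Iic t).indicator fun s => B (f t) (g s) := by
      ext s
      simp only [indicator, mem_ofPred_eq, mem_Iic, hh]
    simp only [this]
    rw [integral_indicator measurableSet_Iic, hr1 t ht]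
    exact (B (f t)).integral_comp_comm (hg.mono_set (Ioc_subset_Ioc_right ht.2))
  have e2 : ∫ p in {p : ℝ × ℝ | p.2 ≤ p.1}ᶜ, h p ∂(μ.prod μ) =
      ∫ t in Ioc a b, B (∫ s in Ioc a t, f s) (g t) := by
    rw [← integral_indicator hD.compl, integral_prod_symm _ (hI.indicator hD.compl)]
    refine setIntegral_congr_fun measurableSet_Ioc fun t ht => ?_
    have : (fun s => {p : ℝ × ℝ | p.2 ≤ p.1}ᶜ.indicator h (s, t)) =
        (Iio t).indicator fun s => B.flip (g t) (f s) := by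
      ext s
      simp only [indicator, mem_compl_iff, mem_ofPred_eq, not_le, mem_Iio, hh,
        ContinuousLinearMap.flip_apply]
    simp only [this]
    rw [integral_indicator measurableSet_Iio, hr2 t ht]
    exact (B.flip (g t)).integral_comp_comm (hf.mono_set (Ioc_subset_Ioc_right ht.2))
  rw [← e1, ← e2, integral_add_compl hD hI, integral_prod _ hI]
  have e3 : ∀ t, ∫ s, h (t, s) ∂μ = B.flip (∫ s, g s ∂μ) (f t) := fun t =>
    (B (f t)).integral_comp_comm hg
  simp only [e3]
  exact (B.flip _).integral_comp_comm hf

/-- Integration by parts. -/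
lemma IsPrimitiveOn.integral_bilin (B : V →L[ℝ] W →L[ℝ] G) {f u : ℝ → V} {g v : ℝ → W}
    (hab : a ≤ b) (hf : IntegrableOn f (Ioo a b)) (hg : IntegrableOn g (Ioo a b))
    (hu : IsPrimitiveOn a b u f) (hv : IsPrimitiveOn a b v g) :
    (∫ t in Ioo a b, B (f t) (v t)) + ∫ t in Ioo a b, B (u t) (g t) =
      B (u b) (v b) - B (u a) (v a) := by
  have hcu := hu.continuousOn hf
  have hcv := hv.continuousOn hg
  have hf' : IntegrableOn f (Ioc a b) := by rwa [integrableOn_Ioc_iff_integrableOn_Ioo]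
  have hg' : IntegrableOn g (Ioc a b) := by rwa [integrableOn_Ioc_iff_integrableOn_Ioo]
  have key := integral_bilin_primitive B hf' hg'
  have hu' : ∀ t ∈ Icc a b, ∫ s in Ioc a t, f s = u t - u a := fun t ht => by
    rw [hu t ht, intervalIntegral.integral_of_le ht.1, add_sub_cancel_left]
  have hv' : ∀ t ∈ Icc a b, ∫ s in Ioc a t, g s = v t - v a := fun t ht => by
    rw [hv t ht, intervalIntegral.integral_of_le ht.1, add_sub_cancel_left]
  have e1 : ∫ t in Ioc a b, B (f t) (∫ s in Ioc a t, g s) =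
      (∫ t in Ioo a b, B (f t) (v t)) - B (u b - u a) (v a) := by
    rw [← hu' b (right_mem_Icc.2 hab), setIntegral_congr_fun measurableSet_Ioc
      (g := fun t => B (f t) (v t) - B.flip (v a) (f t))
      fun t ht => by simp [hv' t (Ioc_subset_Icc_self ht)]]
    rw [integral_sub, (B.flip (v a)).integral_comp_comm hf', integral_Ioc_eq_integral_Ioo]
    · rfl
    · exact (integrableOn_Ioc_iff_integrableOn_Ioo (μ := volume)).2 (integrableOn_bilin B hf hcv)
    · exact (B.flip (v a)).integrable_comp hf'
  have e2 : ∫ t in Ioc a b, B (∫ s in Ioc a t, f s) (g t) =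
      (∫ t in Ioo a b, B (u t) (g t)) - B (u a) (v b - v a) := by
    rw [← hv' b (right_mem_Icc.2 hab), setIntegral_congr_fun measurableSet_Ioc
      (g := fun t => B (u t) (g t) - B (u a) (g t))
      fun t ht => by simp [hu' t (Ioc_subset_Icc_self ht)]]
    rw [integral_sub, (B (u a)).integral_comp_comm hg', integral_Ioc_eq_integral_Ioo]
    · exact (integrableOn_Ioc_iff_integrableOn_Ioo (μ := volume)).2 (integrableOn_bilin B.flip hg hcu)
    · exact (B (u a)).integrable_comp hg'
  rw [e1, e2, hu' b (right_mem_Icc.2 hab), hv' b (right_mem_Icc.2 hab)] at key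
  simp only [map_sub, _root_.sub_apply] at key
  have : ∀ x y p q r s : G, x - (p - q) + (y - (r - q)) = s - r - (p - q) → x + y = s - q := by
    intro x y p q r s h
    calc x + y = x - (p - q) + (y - (r - q)) + (p - q) + (r - q) := by abel
      _ = _ := by rw [h]; abel
  exact this _ _ _ _ _ _ key

end Primitive

/-! ### The lemma of du Bois-Reymond -/

section WeakDeriv

variable {d : ℕ} {a b : ℝ}

/-- Integration by parts against the test function, which vanishes at both endpoints. -/
lemma hasWeakDeriv_of_isPrimitiveOn (hab : a ≤ b) {f u g : ℝ → EuclideanSpace ℂ (Fin d)}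
    (hg : IntegrableOn g (Ioo a b)) (hu : IsPrimitiveOn a b u g)
    (hf : ∀ᵐ t ∂(volume.restrict (Ioo a b)), f t = u t) : HasWeakDeriv a b f g := by
  intro φ h h' h''
  have hd : Continuous (deriv φ) := h.continuous_deriv (by simp)
  have hφ : IsPrimitiveOn a b φ (deriv φ) :=
    isPrimitiveOn_of_hasDerivAt hd fun t => (h.differentiable (by simp) t).hasDerivAt
  have h0 : ∀ t, t ∉ Ioo a b → φ t = 0 := fun t ht => image_eq_zero_of_notMem_tsupport
    fun hn => ht (h'' hn)
  have key := IsPrimitiveOn.integral_bilin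
    (ContinuousLinearMap.lsmul ℝ ℝ : ℝ →L[ℝ] EuclideanSpace ℂ (Fin d) →L[ℝ] _) hab
    ((hd.integrableOn_Icc).mono_set Ioo_subset_Icc_self) hg hφ hu
  simp only [ContinuousLinearMap.lsmul_apply, h0 a (by simp), h0 b (by simp), zero_smul,
    sub_zero] at key
  rw [← eq_neg_iff_add_eq_zero] at key
  rw [← key]
  refine integral_congr_ae ?_
  filter_upwards [hf] with t ht
  simp only [ht]

/-- A smooth function with compact support in `(a, b)` and vanishing integral is the derivative
of such a function. -/
lemma exists_test_primitive {φ : ℝ → ℝ} (h : ContDiff ℝ (⊤ : ℕ∞) φ)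
    (h' : HasCompactSupport φ) (h'' : tsupport φ ⊆ Ioo a b) (h0 : ∫ t in a..b, φ t = 0) :
    ∃ ψ : ℝ → ℝ, ContDiff ℝ (⊤ : ℕ∞) ψ ∧ HasCompactSupport ψ ∧ tsupport ψ ⊆ Ioo a b ∧
      ∀ t, deriv ψ t = φ t := by
  rcases (tsupport φ).eq_empty_or_nonempty with hne | hne
  · refine ⟨0, contDiff_const, HasCompactSupport.zero, ?_, ?_⟩
    · simp [tsupport]
    · intro t
      have : φ t = 0 := image_eq_zero_of_notMem_tsupport (by simp [hne])
      rw [this]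
      exact deriv_const t 0
  have hc : IsCompact (tsupport φ) := h'
  -- With `[p, q]` spanned by the support, the primitive from `a` vanishes to the left of `p`
  -- trivially and to the right of `q` because the total integral is zero.
  obtain ⟨p, hp, hp'⟩ := hc.exists_isLeast hne
  obtain ⟨q, hq, hq'⟩ := hc.exists_isGreatest hne
  have hap := (h'' hp).1
  have hqb := (h'' hq).2
  have hd : ∀ t, HasDerivAt (fun t => ∫ s in a..t, φ s) (φ t) t := fun t =>
    intervalIntegral.integral_hasDerivAt_right (h.continuous.intervalIntegrable _ _)
      (h.continuous.stronglyMeasurableAtFilter _ _) h.continuous.continuousAt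
  have hd' : deriv (fun t => ∫ s in a..t, φ s) = φ := funext fun t => (hd t).deriv
  have hz : ∀ t, t ∉ Icc p q → ∫ s in a..t, φ s = 0 := by
    intro t ht
    by_cases htp : t < p
    · refine intervalIntegral.integral_zero_ae (.of_forall fun s hs => ?_)
      refine image_eq_zero_of_notMem_tsupport fun hn => ?_
      have := hp' hn
      rcases mem_uIoc.1 hs with hs | hs <;> linarith [hs.2]
    · have htq : q < t := by
        by_contra hn
        exact ht ⟨not_lt.1 htp, not_lt.1 hn⟩
      have hsub := intervalIntegral.integral_interval_sub_left
        (h.continuous.intervalIntegrable (μ := volume) a b) (h.continuous.intervalIntegrable a t)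
      rw [h0, zero_sub, intervalIntegral.integral_zero_ae (a := t) (.of_forall fun s hs => ?_),
        neg_eq_zero] at hsub
      · exact hsub
      · refine image_eq_zero_of_notMem_tsupport fun hn => ?_
        have := hq' hn
        rcases mem_uIoc.1 hs with hs | hs <;> linarith [hs.1]
  have hts : tsupport (fun t => ∫ s in a..t, φ s) ⊆ Icc p q :=
    closure_minimal (fun t ht => by_contra fun hn => ht (hz t hn)) isClosed_Icc
  refine ⟨fun t => ∫ s in a..t, φ s, ?_, HasCompactSupport.intro isCompact_Icc hz,
    hts.trans (Icc_subset_Ioo hap hqb), fun t => (hd t).deriv⟩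
  refine contDiff_infty_iff_deriv.2 ⟨fun t => (hd t).differentiableAt, ?_⟩
  rw [hd']
  exact h

/-- The lemma of du Bois-Reymond. -/
lemma HasWeakDeriv.exists_isPrimitiveOn (hab : a < b) {f g : ℝ → EuclideanSpace ℂ (Fin d)}
    (hf : IntegrableOn f (Ioo a b)) (hg : IntegrableOn g (Ioo a b)) (hfg : HasWeakDeriv a b f g) :
    ∃ u, IsPrimitiveOn a b u g ∧ ∀ᵐ t ∂(volume.restrict (Ioo a b)), f t = u t := by
  -- The difference `f - h` has weak derivative zero, hence is orthogonal to test functions of mean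
  -- zero; it remains to see that it is constant.
  set h : ℝ → EuclideanSpace ℂ (Fin d) := fun t => ∫ s in a..t, g s with hh
  have hprim : IsPrimitiveOn a b h g := fun t _ => by simp [hh]
  have hhc : IntegrableOn h (Ioo a b) :=
    ((hprim.continuousOn hg).integrableOn_Icc).mono_set Ioo_subset_Icc_self
  have hhg := hasWeakDeriv_of_isPrimitiveOn hab.le hg hprim (f := h) (.of_forall fun _ => rfl)
  have hw : IntegrableOn (f - h) (Ioo a b) := hf.sub hhc
  have hsm : ∀ {φ : ℝ → ℝ} {w : ℝ → EuclideanSpace ℂ (Fin d)}, Continuous φ →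
      IntegrableOn w (Ioo a b) → IntegrableOn (fun t => φ t • w t) (Ioo a b) := fun hφ hw =>
    integrableOn_bilin (ContinuousLinearMap.lsmul ℝ ℝ : ℝ →L[ℝ] EuclideanSpace ℂ (Fin d) →L[ℝ] _).flip
      hw hφ.continuousOn
  have hort : ∀ φ : ℝ → ℝ, ContDiff ℝ (⊤ : ℕ∞) φ → HasCompactSupport φ → tsupport φ ⊆ Ioo a b →
      ∫ t in a..b, φ t = 0 → ∫ t in Ioo a b, φ t • (f - h) t = 0 := by
    intro φ h1 h2 h3 h4
    obtain ⟨ψ, k1, k2, k3, k4⟩ := exists_test_primitive h1 h2 h3 h4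
    have hd : Continuous (deriv ψ) := k1.continuous_deriv (by simp)
    simp only [← k4, Pi.sub_apply, smul_sub]
    rw [integral_sub (hsm hd hf) (hsm hd hhc), hfg ψ k1 k2 k3, hhg ψ k1 k2 k3, sub_self]
  -- For a fixed bump `ψ` with integral `1` and any test function `φ`, the function `φ - (∫ φ) ψ`
  -- has mean zero. Testing with it identifies the constant as `c = ∫ ψ (f - h)`. The outer radius
  -- keeps the support inside `(a, b)`.
  let B : ContDiffBump ((a + b) / 2) := ⟨(b - a) / 8, (b - a) / 4, by linarith, by linarith⟩
  set ψ := B.normed volume with hψ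
  have p1 : ContDiff ℝ (⊤ : ℕ∞) ψ := B.contDiff_normed
  have p2 : HasCompactSupport ψ := B.hasCompactSupport_normed
  have p3 : tsupport ψ ⊆ Ioo a b := by
    rw [hψ, B.tsupport_normed_eq, Real.closedBall_eq_Icc]
    refine Icc_subset_Ioo ?_ ?_
    · change a < (a + b) / 2 - (b - a) / 4
      linarith
    · change (a + b) / 2 + (b - a) / 4 < b
      linarith
  have p4 : ∫ t in a..b, ψ t = 1 := by
    rw [intervalIntegral.integral_of_le hab.le, integral_Ioc_eq_integral_Ioo,
      setIntegral_eq_integral_of_forall_compl_eq_zero fun t ht =>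
        image_eq_zero_of_notMem_tsupport fun hn => ht (p3 hn)]
    exact B.integral_normed
  set c := ∫ t in Ioo a b, ψ t • (f - h) t with hc
  have hfc : IntegrableOn (fun t => (f - h) t - c) (Ioo a b) :=
    hw.sub (integrableOn_const (by simp))
  have hae := IsOpen.ae_eq_zero_of_integral_contDiff_smul_eq_zero
    (μ := volume.restrict (Ioo a b)) (f := fun t => (f - h) t - c) (isOpen_Ioo (a := a) (b := b))
    (Integrable.locallyIntegrable hfc |>.locallyIntegrableOn _) (fun φ h1 h2 h3 => by
      set m := ∫ t in a..b, φ t with hm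
      have q := hort (fun t => φ t - m * ψ t) (h1.sub (contDiff_const.mul p1))
        (h2.sub p2.mul_left)
        ((tsupport_sub φ (fun t => m * ψ t)).trans
          (union_subset h3 ((tsupport_mul_subset_right).trans p3)))
        (by
          rw [intervalIntegral.integral_sub (g := fun t => m * ψ t)
            (h1.continuous.intervalIntegrable _ _)
            ((continuous_const.mul p1.continuous).intervalIntegrable _ _),
            intervalIntegral.integral_const_mul, p4, mul_one, sub_self])
      simp only [sub_smul, mul_smul] at q
      rw [integral_sub (g := fun t => m • ψ t • (f - h) t) (hsm h1.continuous hw)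
        ((hsm p1.continuous hw).smul m), integral_smul,
        ← hc] at q
      simp only [smul_sub]
      rw [integral_sub (hsm h1.continuous hw) (hsm h1.continuous (integrableOn_const (by simp))),
        integral_smul_const, ← integral_Ioc_eq_integral_Ioo (f := φ),
        ← intervalIntegral.integral_of_le hab.le]
      exact q)
  refine ⟨fun t => c + h t, fun t _ => by simp [hh], ?_⟩
  filter_upwards [hae, ae_restrict_mem measurableSet_Ioo] with t ht ht'
  have := ht ht'
  rw [Pi.sub_apply, sub_sub, sub_eq_zero] at this
  rw [this, add_comm]

/-- Boundary values are therefore well defined. -/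
lemma IsContRep.eqOn (hab : a < b) {f u v : ℝ → EuclideanSpace ℂ (Fin d)}
    (hu : IsContRep a b f u) (hv : IsContRep a b f v) : EqOn u v (Icc a b) := by
  refine Measure.eqOn_Icc_of_ae_eq volume hab.ne ?_ hu.1 hv.1
  rw [← restrict_Ioo_eq_restrict_Icc]
  filter_upwards [hu.2, hv.2] with t h1 h2
  rw [← h1, h2]

end WeakDeriv

/-! ### Green's identity on an edge -/

section Edge

open scoped InnerProductSpace

variable {d : ℕ} {a b : ℝ}

lemma IsPrimitiveOn.congr_ae {u f g : ℝ → EuclideanSpace ℂ (Fin d)} (h : IsPrimitiveOn a b u f)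
    (hfg : ∀ᵐ t ∂(volume.restrict (Ioo a b)), f t = g t) : IsPrimitiveOn a b u g := by
  intro t ht
  rw [h t ht, intervalIntegral.integral_of_le ht.1, intervalIntegral.integral_of_le ht.1,
    integral_Ioc_eq_integral_Ioo, integral_Ioc_eq_integral_Ioo]
  congr 1
  exact integral_congr_ae (ae_restrict_of_ae_restrict_of_subset (Ioo_subset_Ioo_right ht.2) hfg)

lemma integrableOn_Lp (x : Lp (EuclideanSpace ℂ (Fin d)) 2 (volume.restrict (Ioo a b))) :
    IntegrableOn x (Ioo a b) :=
  (Lp.memLp x).integrable (by norm_num)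

lemma memLp_of_continuous {u : ℝ → EuclideanSpace ℂ (Fin d)} (hu : Continuous u) (a b : ℝ) :
    MemLp u 2 (volume.restrict (Ioo a b)) := by
  obtain ⟨C, hC⟩ := (isCompact_Icc (a := a) (b := b)).exists_bound_of_continuousOn hu.continuousOn
  refine MemLp.of_bound hu.aestronglyMeasurable C ?_
  filter_upwards [ae_restrict_mem measurableSet_Ioo] with t ht
  exact hC t (Ioo_subset_Icc_self ht)

/-- The class in `L²(a, b)` of a continuous function. -/
noncomputable def edgeLp (a b : ℝ) (u : ℝ → EuclideanSpace ℂ (Fin d)) (hu : Continuous u) :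
    Lp (EuclideanSpace ℂ (Fin d)) 2 (volume.restrict (Ioo a b)) :=
  (memLp_of_continuous hu a b).toLp u

lemma coeFn_edgeLp {u : ℝ → EuclideanSpace ℂ (Fin d)} (hu : Continuous u) :
    ∀ᵐ t ∂(volume.restrict (Ioo a b)), edgeLp a b u hu t = u t :=
  (memLp_of_continuous hu a b).coeFn_toLp

lemma isContRep_edgeLp {u : ℝ → EuclideanSpace ℂ (Fin d)} (hu : Continuous u) :
    IsContRep a b (edgeLp a b u hu) u :=
  ⟨hu.continuousOn, coeFn_edgeLp hu⟩

lemma inner_edge (x y : Lp (EuclideanSpace ℂ (Fin d)) 2 (volume.restrict (Ioo a b))) :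
    ⟪x, y⟫_ℂ = ∫ t in Ioo a b, ⟪x t, y t⟫_ℂ := L2.inner_def x y

variable (P Q : Matrix (Fin d) (Fin d) ℂ)

lemma continuous_toEuclideanLin : Continuous P.toEuclideanLin :=
  LinearMap.continuous_of_finiteDimensional _

variable {P Q}

lemma toEuclideanLin_apply_apply (h : P * Q = 1) (v : EuclideanSpace ℂ (Fin d)) :
    P.toEuclideanLin (Q.toEuclideanLin v) = v := by
  apply (WithLp.ofLp_injective 2)
  change P *ᵥ (Q *ᵥ v.ofLp) = v.ofLp
  rw [mulVec_mulVec, h, one_mulVec]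

lemma inner_toEuclideanLin (hP : P.IsHermitian) (v w : EuclideanSpace ℂ (Fin d)) :
    ⟪P.toEuclideanLin v, w⟫_ℂ = ⟪v, P.toEuclideanLin w⟫_ℂ :=
  (isSymmetric_toEuclideanLin_iff.2 hP) v w

/-- The pairing `⟨v, Q w⟩`. -/
noncomputable def edgeForm (Q : Matrix (Fin d) (Fin d) ℂ) :
    EuclideanSpace ℂ (Fin d) →L[ℝ] EuclideanSpace ℂ (Fin d) →L[ℝ] ℂ :=
  (LinearMap.mk₂ ℝ (fun v w => ⟪v, Q.toEuclideanLin w⟫_ℂ)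
    (fun _ _ _ => inner_add_left _ _ _) (fun c _ _ => by simp [inner_smul_left_eq_smul])
    (fun _ _ _ => by rw [map_add]; exact inner_add_right _ _ _)
    (fun c v w => by
      rw [LinearMap.map_smul_of_tower]
      exact inner_smul_right_eq_smul v (Q.toEuclideanLin w) c)).mkContinuous₂
    ‖LinearMap.toContinuousLinearMap Q.toEuclideanLin‖ fun v w => by
      refine (norm_inner_le_norm (𝕜 := ℂ) v (Q.toEuclideanLin w)).trans ?_
      rw [mul_comm ‖LinearMap.toContinuousLinearMap Q.toEuclideanLin‖, mul_assoc]
      exact mul_le_mul_of_nonneg_left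
        ((LinearMap.toContinuousLinearMap Q.toEuclideanLin).le_opNorm w) (norm_nonneg _)

lemma edgeForm_apply (v w : EuclideanSpace ℂ (Fin d)) :
    edgeForm Q v w = ⟪v, Q.toEuclideanLin w⟫_ℂ := rfl

/-- Green's identity. -/
lemma edge_green (hab : a < b) (hP : P.IsHermitian) (hPQ : P * Q = 1)
    {x y x' y' : Lp (EuclideanSpace ℂ (Fin d)) 2 (volume.restrict (Ioo a b))}
    {u u' : ℝ → EuclideanSpace ℂ (Fin d)} (hu : IsContRep a b x u) (hu' : IsContRep a b x' u')
    (hy : IsPrimitiveOn a b (fun t => P.toEuclideanLin (u t)) y)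
    (hy' : IsPrimitiveOn a b (fun t => P.toEuclideanLin (u' t)) y') :
    ⟪y, x'⟫_ℂ + ⟪x, y'⟫_ℂ =
      ⟪u b, P.toEuclideanLin (u' b)⟫_ℂ - ⟪u a, P.toEuclideanLin (u' a)⟫_ℂ := by
  have hQP : Q * P = 1 := mul_eq_one_comm.1 hPQ
  have hPi : ∀ v w : EuclideanSpace ℂ (Fin d),
      ⟪P.toEuclideanLin v, Q.toEuclideanLin w⟫_ℂ = ⟪v, w⟫_ℂ := fun v w => by
    rw [inner_toEuclideanLin hP, toEuclideanLin_apply_apply hPQ]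
  -- The functions with known derivatives are `P u` and `P u'`. Pairing them through `Q = P⁻¹`
  -- removes the surplus factor `P` in each term.
  have key := hy.integral_bilin (edgeForm Q) hab.le (integrableOn_Lp y) (integrableOn_Lp y') hy'
  simp only [edgeForm_apply, hPi, toEuclideanLin_apply_apply hQP] at key
  rw [inner_toEuclideanLin hP, inner_toEuclideanLin hP] at key
  rw [inner_edge, inner_edge, ← key]
  congr 1
  · refine integral_congr_ae ?_
    filter_upwards [hu'.2] with t ht
    rw [ht]
  · refine integral_congr_ae ?_
    filter_upwards [hu.2] with t ht
    rw [ht]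

/-- The lemma of du Bois-Reymond regularizes `P x`, and applying `Q = P⁻¹` recovers `x`. -/
lemma exists_contRep_of_hasWeakDeriv (hab : a < b) (hPQ : P * Q = 1)
    {x y : Lp (EuclideanSpace ℂ (Fin d)) 2 (volume.restrict (Ioo a b))}
    (h : HasWeakDeriv a b (fun t => P.toEuclideanLin (x t)) y) :
    ∃ u, IsContRep a b x u ∧ IsPrimitiveOn a b (fun t => P.toEuclideanLin (u t)) y := by
  have hQP : Q * P = 1 := mul_eq_one_comm.1 hPQ
  have hi : IntegrableOn (fun t => P.toEuclideanLin (x t)) (Ioo a b) :=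
    (LinearMap.toContinuousLinearMap P.toEuclideanLin).integrable_comp (integrableOn_Lp x)
  obtain ⟨w, hw, hxw⟩ := h.exists_isPrimitiveOn hab hi (integrableOn_Lp y)
  refine ⟨fun t => Q.toEuclideanLin (w t), ⟨?_, ?_⟩, ?_⟩
  · exact (continuous_toEuclideanLin Q).comp_continuousOn (hw.continuousOn (integrableOn_Lp y))
  · filter_upwards [hxw] with t ht
    rw [← ht, toEuclideanLin_apply_apply hQP]
  · simpa only [toEuclideanLin_apply_apply hPQ] using hw

lemma IsContRep.isPrimitiveOn (hab : a < b) (hPQ : P * Q = 1)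
    {x y : Lp (EuclideanSpace ℂ (Fin d)) 2 (volume.restrict (Ioo a b))}
    (h : HasWeakDeriv a b (fun t => P.toEuclideanLin (x t)) y)
    {u : ℝ → EuclideanSpace ℂ (Fin d)} (hu : IsContRep a b x u) :
    IsPrimitiveOn a b (fun t => P.toEuclideanLin (u t)) y := by
  obtain ⟨v, hv, hv'⟩ := exists_contRep_of_hasWeakDeriv hab hPQ h
  have huv := hu.eqOn hab hv
  intro t ht
  simp only [huv ht, huv (left_mem_Icc.2 hab.le)]
  exact hv' t ht

lemma hasWeakDeriv_of_contRep (hab : a < b)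
    {x y : Lp (EuclideanSpace ℂ (Fin d)) 2 (volume.restrict (Ioo a b))}
    {u : ℝ → EuclideanSpace ℂ (Fin d)} (hu : IsContRep a b x u)
    (hy : IsPrimitiveOn a b (fun t => P.toEuclideanLin (u t)) y) :
    HasWeakDeriv a b (fun t => P.toEuclideanLin (x t)) y := by
  refine hasWeakDeriv_of_isPrimitiveOn hab.le (integrableOn_Lp y) hy ?_
  filter_upwards [hu.2] with t ht
  rw [ht]

lemma isPrimitiveOn_edgeLp {u u' : ℝ → EuclideanSpace ℂ (Fin d)}
    (hu' : Continuous fun t => P.toEuclideanLin (u' t)) (h : ∀ t, HasDerivAt u (u' t) t) :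
    IsPrimitiveOn a b (fun t => P.toEuclideanLin (u t)) (edgeLp a b _ hu') := by
  refine (isPrimitiveOn_of_hasDerivAt hu' fun t => ?_).congr_ae
    ((coeFn_edgeLp hu').mono fun t ht => ht.symm)
  exact ((LinearMap.toContinuousLinearMap P.toEuclideanLin).restrictScalars ℝ).hasFDerivAt.comp_hasDerivAt
    t (h t)

lemma hasWeakDeriv_edgeLp (hab : a < b) {u u' : ℝ → EuclideanSpace ℂ (Fin d)} (hu : Continuous u)
    (hu' : Continuous fun t => P.toEuclideanLin (u' t)) (h : ∀ t, HasDerivAt u (u' t) t) :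
    HasWeakDeriv a b (fun t => P.toEuclideanLin (edgeLp a b u hu t)) (edgeLp a b _ hu') :=
  hasWeakDeriv_of_contRep hab (isContRep_edgeLp hu) (isPrimitiveOn_edgeLp hu' h)

end Edge

/-! ### The maximal operator on the network -/

section Network

open scoped InnerProductSpace

variable {E : Type*} {d : ℕ} {P Q : Matrix (Fin d) (Fin d) ℂ} {a b : E → ℝ}

/-- `y` is the weak derivative of `P x` on every edge. -/
def IsMaxPair (P : Matrix (Fin d) (Fin d) ℂ) (x y : NetL2 d a b) : Prop :=
  ∀ e, HasWeakDeriv (a e) (b e) (fun t => P.toEuclideanLin (x e t)) (y e)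

lemma isMaxPair_of_mem_netGraph {x y : NetL2 d a b} (h : (x, y) ∈ netGraph P a b) :
    IsMaxPair P x y := fun e => (h e).1

-- Vectors supported on one edge allow identities on the whole network to be tested edge by edge.
open scoped Classical in
lemma isMaxPair_single {e : E}
    {x y : Lp (EuclideanSpace ℂ (Fin d)) 2 (volume.restrict (Ioo (a e) (b e)))}
    (h : HasWeakDeriv (a e) (b e) (fun t => P.toEuclideanLin (x t)) y) :
    IsMaxPair P (lp.single 2 e x : NetL2 d a b) (lp.single 2 e y) := by
  intro e'
  by_cases he : e' = e
  · subst he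
    rw [lp.single_apply_self, lp.single_apply_self]
    exact h
  · rw [lp.single_apply_ne _ _ _ he, lp.single_apply_ne _ _ _ he]
    exact ((netGraph P a b).zero_mem e').1

open scoped Classical in
lemma single_mem_netGraph {e : E}
    {x y : Lp (EuclideanSpace ℂ (Fin d)) 2 (volume.restrict (Ioo (a e) (b e)))}
    (h : HasWeakDeriv (a e) (b e) (fun t => P.toEuclideanLin (x t)) y)
    {u : ℝ → EuclideanSpace ℂ (Fin d)} (hu : IsContRep (a e) (b e) x u) (ha : u (a e) = 0)
    (hb : u (b e) = 0) :
    (lp.single 2 e x, lp.single 2 e y) ∈ netGraph P a b := by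
  intro e'
  refine ⟨isMaxPair_single h e', ?_⟩
  by_cases he : e' = e
  · subst he
    rw [lp.single_apply_self]
    exact ⟨u, hu, ha, hb⟩
  · rw [lp.single_apply_ne _ _ _ he]
    exact ((netGraph P a b).zero_mem e').2

/-- The boundary terms are summable because the inner products in the direct sum are; neither
endpoint contribution is claimed to be summable on its own. -/
lemma hasSum_green (hab : ∀ e, a e < b e) (hP : P.IsHermitian) (hPQ : P * Q = 1)
    {x y x' y' : NetL2 d a b} (h : IsMaxPair P x y) (h' : IsMaxPair P x' y')
    {u u' : E → ℝ → EuclideanSpace ℂ (Fin d)} (hu : ∀ e, IsContRep (a e) (b e) (x e) (u e))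
    (hu' : ∀ e, IsContRep (a e) (b e) (x' e) (u' e)) :
    HasSum (fun e => ⟪u e (b e), P.toEuclideanLin (u' e (b e))⟫_ℂ -
      ⟪u e (a e), P.toEuclideanLin (u' e (a e))⟫_ℂ) (⟪y, x'⟫_ℂ + ⟪x, y'⟫_ℂ) := by
  have hf := funext fun e => edge_green (hab e) hP hPQ (hu e) (hu' e)
    ((hu e).isPrimitiveOn (hab e) hPQ (h e)) ((hu' e).isPrimitiveOn (hab e) hPQ (h' e))
  rw [← hf]
  exact (lp.hasSum_inner y x').add (lp.hasSum_inner x y')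

lemma green_of_mem_netGraph (hab : ∀ e, a e < b e) (hP : P.IsHermitian) (hPQ : P * Q = 1)
    {x y x' y' : NetL2 d a b} (h : IsMaxPair P x y) (h' : (x', y') ∈ netGraph P a b) :
    ⟪y, x'⟫_ℂ + ⟪x, y'⟫_ℂ = 0 := by
  choose u hu _ using fun e => exists_contRep_of_hasWeakDeriv (hab e) hPQ (h e)
  choose u' hu' ha hb using fun e => (h' e).2
  refine (hasSum_green hab hP hPQ h (isMaxPair_of_mem_netGraph h') hu hu').unique ?_
  simp only [ha, hb, map_zero, inner_zero_right, sub_zero]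
  exact hasSum_zero

/-- The test functions in the domain of the minimal operator determine weak derivatives. -/
lemma isMaxPair_of_forall (hab : ∀ e, a e < b e) (hP : P.IsHermitian) {x y : NetL2 d a b}
    (h : ∀ u v, (u, v) ∈ netGraph P a b → ⟪v, x⟫_ℂ + ⟪u, y⟫_ℂ = 0) : IsMaxPair P x y := by
  classical
  intro e φ h1 h2 h3
  have hd : Continuous (deriv φ) := h1.continuous_deriv (by simp)
  have h0 : ∀ t, t ∉ Ioo (a e) (b e) → φ t = 0 := fun t ht =>
    image_eq_zero_of_notMem_tsupport fun hn => ht (h3 hn)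
  -- The test vectors are `φ w`, supported on the edge `e`, with `w` an arbitrary constant.
  refine ext_inner_left ℂ fun w => ?_
  have hu : Continuous fun t => φ t • w := h1.continuous.smul continuous_const
  have hu' : Continuous fun t => P.toEuclideanLin (deriv φ t • w) :=
    (continuous_toEuclideanLin P).comp (hd.smul continuous_const)
  have hder : ∀ t, HasDerivAt (fun t => φ t • w) (deriv φ t • w) t := fun t =>
    (h1.differentiable (by simp) t).hasDerivAt.smul_const w
  have key := h _ _ (single_mem_netGraph (hasWeakDeriv_edgeLp (hab e) hu hu' hder)
    (isContRep_edgeLp hu) (by simp [h0]) (by simp [h0]))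
  rw [lp.inner_single_left, lp.inner_single_left, inner_edge, inner_edge] at key
  rw [inner_neg_right, ← integral_inner (integrable_test_smul_matrix P hd h2.deriv _),
    ← integral_inner (integrable_test_smul h1.continuous h2 _), ← add_eq_zero_iff_eq_neg, ← key]
  congr 1
  · refine integral_congr_ae ?_
    filter_upwards [coeFn_edgeLp hu'] with t ht
    rw [ht, inner_toEuclideanLin hP, inner_smul_left_eq_smul, inner_smul_right_eq_smul]
  · refine integral_congr_ae ?_
    filter_upwards [coeFn_edgeLp hu] with t ht
    rw [ht, inner_smul_left_eq_smul, inner_smul_right_eq_smul]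

/-- Testing with the minimal domain already gives the weak derivative. Affine functions `(t - c) w`
on a single edge, which need not vanish at the endpoints, then detect the boundary values. -/
lemma mem_netGraph_of_forall (hab : ∀ e, a e < b e) (hP : P.IsHermitian) (hPQ : P * Q = 1)
    {x y : NetL2 d a b} (h : ∀ u v, IsMaxPair P u v → ⟪v, x⟫_ℂ + ⟪u, y⟫_ℂ = 0) :
    (x, y) ∈ netGraph P a b := by
  classical
  have hmax := isMaxPair_of_forall hab hP fun u v huv => h u v (isMaxPair_of_mem_netGraph huv)
  intro e
  obtain ⟨u, hu, hup⟩ := exists_contRep_of_hasWeakDeriv (hab e) hPQ (hmax e)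
  refine ⟨hmax e, u, hu, ?_⟩
  have key : ∀ c : ℝ, ∀ w : EuclideanSpace ℂ (Fin d),
      ⟪(b e - c) • w, P.toEuclideanLin (u (b e))⟫_ℂ -
        ⟪(a e - c) • w, P.toEuclideanLin (u (a e))⟫_ℂ = 0 := by
    intro c w
    have hv : Continuous fun t : ℝ => (t - c) • w := by fun_prop
    have hv' : Continuous fun _ : ℝ => P.toEuclideanLin w := continuous_const
    have hder : ∀ t : ℝ, HasDerivAt (fun t : ℝ => (t - c) • w) w t := fun t => by
      simpa using ((hasDerivAt_id t).sub_const c).smul_const w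
    have k1 := h _ _ (isMaxPair_single (hasWeakDeriv_edgeLp (hab e) hv hv' hder))
    rw [lp.inner_single_left, lp.inner_single_left] at k1
    rw [← k1]
    exact (edge_green (hab e) hP hPQ (isContRep_edgeLp hv) hu (isPrimitiveOn_edgeLp hv' hder)
      hup).symm
  have hQP : Q * P = 1 := mul_eq_one_comm.1 hPQ
  have hlen : b e - a e ≠ 0 := (sub_pos.2 (hab e)).ne'
  have hz : ∀ v : EuclideanSpace ℂ (Fin d), (∀ w, ⟪w, P.toEuclideanLin v⟫_ℂ = 0) → v = 0 := by
    intro v hv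
    have := inner_self_eq_zero.1 (hv (P.toEuclideanLin v))
    rw [← toEuclideanLin_apply_apply hQP v, this, map_zero]
  constructor
  · refine hz _ fun w => ?_
    -- The zero `c` is placed at the opposite endpoint, so that only the value at `a e` remains; the
    -- factor normalizes the length.
    have := key (b e) ((b e - a e)⁻¹ • w)
    rw [sub_self, zero_smul, inner_zero_left, zero_sub, neg_eq_zero, ← neg_sub, neg_smul,
      smul_smul, mul_inv_cancel₀ hlen, one_smul, inner_neg_left, neg_eq_zero] at this
    exact this
  · refine hz _ fun w => ?_
    have := key (a e) ((b e - a e)⁻¹ • w)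
    rw [sub_self, zero_smul, inner_zero_left, sub_zero, 
      smul_smul, mul_inv_cancel₀ hlen, one_smul] at this
    exact this

open scoped LinearPMap

/-- The domain contains all `φ w` on a single edge with `φ` a test function, and a vector orthogonal
to these vanishes. -/
lemma dense_netOp_domain (hab : ∀ e, a e < b e) :
    Dense ((netOp P a b).domain : Set (NetL2 d a b)) := by
  classical
  rw [Submodule.dense_iff_topologicalClosure_eq_top, Submodule.topologicalClosure_eq_top_iff,
    Submodule.eq_bot_iff]
  intro x hx
  ext1
  funext e
  apply Lp.ext
  have key := IsOpen.ae_eq_zero_of_integral_contDiff_smul_eq_zero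
    (μ := volume.restrict (Ioo (a e) (b e))) (f := x e) (isOpen_Ioo (a := a e) (b := b e))
    (Integrable.locallyIntegrable (integrableOn_Lp (x e)) |>.locallyIntegrableOn _)
    (fun φ h1 h2 h3 => by
      have hd : Continuous (deriv φ) := h1.continuous_deriv (by simp)
      have h0 : ∀ t, t ∉ Ioo (a e) (b e) → φ t = 0 := fun t ht =>
        image_eq_zero_of_notMem_tsupport fun hn => ht (h3 hn)
      refine ext_inner_left ℂ fun w => ?_
      have hu : Continuous fun t => φ t • w := h1.continuous.smul continuous_const
      have hu' : Continuous fun t => P.toEuclideanLin (deriv φ t • w) :=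
        (continuous_toEuclideanLin P).comp (hd.smul continuous_const)
      have hder : ∀ t, HasDerivAt (fun t => φ t • w) (deriv φ t • w) t := fun t =>
        (h1.differentiable (by simp) t).hasDerivAt.smul_const w
      have hmem := single_mem_netGraph (a := a) (b := b) (hasWeakDeriv_edgeLp (hab e) hu hu' hder)
        (isContRep_edgeLp hu) (by simp [h0]) (by simp [h0])
      rw [← netOp_graph] at hmem
      have := (Submodule.mem_orthogonal _ _).1 hx _ (LinearPMap.mem_domain_of_mem_graph hmem)
      rw [lp.inner_single_left, inner_edge] at this
      rw [inner_zero_right, ← integral_inner (integrable_test_smul h1.continuous h2 _), ← this]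
      refine integral_congr_ae ?_
      filter_upwards [coeFn_edgeLp hu] with t ht
      rw [ht, inner_smul_left_eq_smul, inner_smul_right_eq_smul])
  filter_upwards [key, ae_restrict_mem measurableSet_Ioo, Lp.coeFn_zero (EuclideanSpace ℂ (Fin d)) 2
    (volume.restrict (Ioo (a e) (b e)))] with t ht ht' ht''
  rw [ht ht']
  simpa using ht''.symm

/-- Test functions in the minimal domain force the differential equation; conversely, in Green's
identity the boundary terms vanish as soon as one of the two vectors is in the minimal domain. The
sign reflects skew-symmetry. -/
lemma mem_netOp_adjoint_graph (hab : ∀ e, a e < b e) (hP : P.IsHermitian) (hPQ : P * Q = 1)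
    {x z : NetL2 d a b} : (x, z) ∈ ((netOp P a b)†).graph ↔ IsMaxPair P x (-z) := by
  rw [mem_adjoint_graph_iff (dense_netOp_domain hab), netOp_graph]
  constructor
  · intro h
    refine isMaxPair_of_forall hab hP fun u v huv => ?_
    rw [h u v huv, inner_neg_right, add_neg_cancel]
  · intro h u v huv
    have := green_of_mem_netGraph hab hP hPQ h huv
    rw [inner_neg_left, neg_add_eq_zero] at this
    rw [← inner_conj_symm, ← this, inner_conj_symm]

lemma neg_netOp_le_adjoint (hab : ∀ e, a e < b e) (hP : P.IsHermitian) (hPQ : P * Q = 1) :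
    -netOp P a b ≤ (netOp P a b)† := by
  refine LinearPMap.le_of_le_graph ?_
  rintro ⟨x, y⟩ h
  obtain ⟨z, rfl, rfl⟩ := (LinearPMap.mem_graph_iff _).1 h
  rw [mem_netOp_adjoint_graph hab hP hPQ]
  refine isMaxPair_of_mem_netGraph ?_
  rw [← netOp_graph]
  change ((z : NetL2 d a b), -(-(netOp P a b) z)) ∈ _
  rw [neg_neg]
  exact LinearPMap.mem_graph (netOp P a b) z

/-- The graph is the annihilator, under the Green form, of the pairs in the maximal operator, hence
an intersection of closed sets. -/
lemma isClosed_netOp (hab : ∀ e, a e < b e) (hP : P.IsHermitian) (hPQ : P * Q = 1) :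
    (netOp P a b).IsClosed := by
  have hset : ((netOp P a b).graph : Set (NetL2 d a b × NetL2 d a b)) =
      ⋂ p : {p : NetL2 d a b × NetL2 d a b // IsMaxPair P p.1 p.2},
        {q | ⟪p.1.2, q.1⟫_ℂ + ⟪p.1.1, q.2⟫_ℂ = 0} := by
    ext ⟨x, y⟩
    rw [mem_iInter, netOp_graph]
    constructor
    · rintro h ⟨⟨u, v⟩, huv⟩
      exact green_of_mem_netGraph hab hP hPQ huv h
    · intro h
      exact mem_netGraph_of_forall hab hP hPQ fun u v huv => h ⟨(u, v), huv⟩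
  rw [LinearPMap.IsClosed, hset]
  refine isClosed_iInter fun p => isClosed_eq ?_ continuous_const
  fun_prop

end Network

/-! ### Diagonalization of the coefficient matrix -/

section Diagonalization

open scoped InnerProductSpace

variable {d : ℕ} {ι : Type*} {S : Matrix ι (Fin d) ℂ} {μ : ι → ℝ}

/-- The vector `s_k` with `(S v)_k = ⟨s_k, v⟩`. -/
noncomputable def rowVec (S : Matrix ι (Fin d) ℂ) (k : ι) : EuclideanSpace ℂ (Fin d) :=
  WithLp.toLp 2 fun j => star (S k j)

lemma inner_rowVec (k : ι) (v : EuclideanSpace ℂ (Fin d)) :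
    ⟪rowVec S k, v⟫_ℂ = (S *ᵥ v.ofLp) k := by
  simp [rowVec, PiLp.inner_apply, mulVec, dotProduct, mul_comm]

lemma inner_rowVec_rowVec [DecidableEq ι] (hS' : S * Sᴴ = 1) (k l : ι) :
    ⟪rowVec S k, rowVec S l⟫_ℂ = if k = l then 1 else 0 := by
  rw [inner_rowVec, ← one_apply, ← hS']
  rfl

lemma eq_zero_of_inner_rowVec [Fintype ι] (hS : Sᴴ * S = 1) {v : EuclideanSpace ℂ (Fin d)}
    (h : ∀ k, ⟪rowVec S k, v⟫_ℂ = 0) : v = 0 := by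
  apply WithLp.ofLp_injective 2
  have h1 : S *ᵥ v.ofLp = 0 := funext fun k => by rw [← inner_rowVec, h]; rfl
  have h2 : Sᴴ *ᵥ (S *ᵥ v.ofLp) = v.ofLp := by rw [mulVec_mulVec, hS, one_mulVec]
  rw [← h2, h1, mulVec_zero]
  rfl

variable [Fintype ι] [DecidableEq ι]

/-- The Hermitian matrix with eigenvalues `μ k` and eigenvectors `s_k`. -/
noncomputable def spectralMatrix (S : Matrix ι (Fin d) ℂ) (μ : ι → ℝ) : Matrix (Fin d) (Fin d) ℂ :=
  Sᴴ * diagonal (fun k => (μ k : ℂ)) * S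

lemma isHermitian_spectralMatrix : (spectralMatrix S μ).IsHermitian := by
  refine isHermitian_conjTranspose_mul_mul S ?_
  refine isHermitian_diagonal_iff.2 fun k => ?_
  simp [isSelfAdjoint_iff]

lemma spectralMatrix_mul_inv (hS : Sᴴ * S = 1) (hS' : S * Sᴴ = 1) (hμ : ∀ k, μ k ≠ 0) :
    spectralMatrix S μ * spectralMatrix S (fun k => (μ k)⁻¹) = 1 := by
  have h : diagonal (fun k => (μ k : ℂ)) * diagonal (fun k => (((μ k)⁻¹ : ℝ) : ℂ)) = 1 := by
    rw [diagonal_mul_diagonal, ← diagonal_one]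
    congr 1
    funext k
    rw [← Complex.ofReal_mul, mul_inv_cancel₀ (hμ k), Complex.ofReal_one]
  calc _ = Sᴴ * (diagonal (fun k => (μ k : ℂ)) * (S * Sᴴ) *
        diagonal (fun k => (((μ k)⁻¹ : ℝ) : ℂ))) * S := by
        simp only [spectralMatrix, Matrix.mul_assoc]
    _ = 1 := by rw [hS', Matrix.mul_one, h, Matrix.mul_one, hS]

lemma inner_rowVec_spectralMatrix (hS' : S * Sᴴ = 1) (k : ι) (v : EuclideanSpace ℂ (Fin d)) :
    ⟪rowVec S k, (spectralMatrix S μ).toEuclideanLin v⟫_ℂ = (μ k : ℂ) * ⟪rowVec S k, v⟫_ℂ := by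
  rw [inner_rowVec, inner_rowVec]
  change (S *ᵥ (spectralMatrix S μ *ᵥ v.ofLp)) k = _
  rw [mulVec_mulVec, spectralMatrix, ← Matrix.mul_assoc, ← Matrix.mul_assoc, hS', Matrix.one_mul,
    ← mulVec_mulVec, mulVec_diagonal]

lemma spectralMatrix_rowVec (hS' : S * Sᴴ = 1) (k : ι) :
    (spectralMatrix S μ).toEuclideanLin (rowVec S k) = (μ k : ℂ) • rowVec S k := by
  refine ext_inner_right ℂ fun v => ?_
  rw [inner_toEuclideanLin isHermitian_spectralMatrix, inner_rowVec_spectralMatrix hS',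
    inner_smul_left, Complex.conj_ofReal]

end Diagonalization

/-! ### Exponential functions -/

section Exponential

open scoped InnerProductSpace

/-- The factors `σ μ` and `1 - exp (-(2 σ ℓ / μ))` have the same sign, as `2 σ ℓ / μ` is a positive
multiple of `σ μ`. -/
lemma expNorm_sq_pos {σ μ ℓ : ℝ} (hσ : σ ≠ 0) (hμ : μ ≠ 0) (hℓ : 0 < ℓ) :
    0 < σ * μ / 2 * (1 - Real.exp (-(2 * σ * ℓ / μ))) := by
  have hd : 2 * σ * ℓ / μ = σ * μ * (2 * ℓ / μ ^ 2) := by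
    field_simp
  have hp : 0 < 2 * ℓ / μ ^ 2 := by positivity
  rcases lt_or_gt_of_ne (mul_ne_zero hσ hμ) with h | h
  · refine mul_pos_of_neg_of_neg (by linarith) ?_
    rw [hd, sub_neg, Real.one_lt_exp_iff]
    have := mul_neg_of_neg_of_pos h hp
    linarith
  · refine mul_pos (by linarith) ?_
    rw [hd, sub_pos, Real.exp_lt_one_iff]
    have := mul_pos h hp
    linarith

lemma expNorm_pos {σ μ ℓ : ℝ} (hσ : σ ≠ 0) (hμ : μ ≠ 0) (hℓ : 0 < ℓ) : 0 < expNorm σ μ ℓ :=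
  Real.sqrt_pos.2 (expNorm_sq_pos hσ hμ hℓ)

lemma integral_exp_sq {σ μ a b : ℝ} (hσ : σ ^ 2 = 1) (hμ : μ ≠ 0) (hab : a < b) :
    ∫ t in Ioo a b, Real.exp (-(σ * (t - a) / μ)) ^ 2 = expNorm σ μ (b - a) ^ 2 := by
  have hσ0 : σ ≠ 0 := by
    rintro rfl
    norm_num at hσ
  rw [expNorm, Real.sq_sqrt (expNorm_sq_pos hσ0 hμ (sub_pos.2 hab)).le,
    ← integral_Ioc_eq_integral_Ioo, ← intervalIntegral.integral_of_le hab.le]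
  have hd : ∀ t ∈ uIcc a b, HasDerivAt (fun t => -(σ * μ / 2) * Real.exp (-(σ * (t - a) / μ)) ^ 2)
      (Real.exp (-(σ * (t - a) / μ)) ^ 2) t := by
    intro t _
    have h1 : HasDerivAt (fun t => -(σ * (t - a) / μ)) (-(σ * 1 / μ)) t :=
      ((((hasDerivAt_id t).sub_const a).const_mul σ).div_const μ).neg
    refine ((h1.exp.fun_pow 2).const_mul (-(σ * μ / 2))).congr_deriv ?_
    have : -(σ * μ / 2) * (-(σ * 1 / μ)) = 2⁻¹ := by
      field_simp
      linarith
    simp only [Nat.cast_ofNat, Nat.add_one_sub_one, pow_one]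
    linear_combination 2 * Real.exp (-(σ * (t - a) / μ)) ^ 2 * this
  rw [intervalIntegral.integral_eq_sub_of_hasDerivAt hd
    (Continuous.intervalIntegrable (by fun_prop) _ _), ← Real.exp_nat_mul, ← Real.exp_nat_mul]
  have : ((2 : ℕ) : ℝ) * -(σ * (b - a) / μ) = -(2 * σ * (b - a) / μ) := by
    push_cast
    ring
  rw [this]
  simp
  ring

variable {d : ℕ} {ι : Type*} [Fintype ι] [DecidableEq ι] {S : Matrix ι (Fin d) ℂ} {μ : ι → ℝ}

/-- The function `t ↦ exp (-σ (t - a) / μ) s`. -/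
noncomputable def expFun (σ μ a : ℝ) (s : EuclideanSpace ℂ (Fin d)) (t : ℝ) :
    EuclideanSpace ℂ (Fin d) :=
  (Real.exp (-(σ * (t - a) / μ)) : ℂ) • s

lemma continuous_expFun (σ μ a : ℝ) (s : EuclideanSpace ℂ (Fin d)) :
    Continuous (expFun σ μ a s) := by
  unfold expFun
  fun_prop

lemma hasDerivAt_expFun (σ μ a : ℝ) (s : EuclideanSpace ℂ (Fin d)) (t : ℝ) :
    HasDerivAt (expFun σ μ a s) ((-σ / μ : ℂ) • expFun σ μ a s t) t := by
  have h1 : HasDerivAt (fun t => -(σ * (t - a) / μ)) (-(σ * 1 / μ)) t :=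
    ((((hasDerivAt_id t).sub_const a).const_mul σ).div_const μ).neg
  have h2 := h1.exp.ofReal_comp.smul_const s
  refine h2.congr_deriv ?_
  rw [expFun, smul_smul]
  congr 1
  push_cast
  ring

/-- The class of `expFun` in `L²(a, b)`. -/
noncomputable def expEdge (σ μ a b : ℝ) (s : EuclideanSpace ℂ (Fin d)) :
    Lp (EuclideanSpace ℂ (Fin d)) 2 (volume.restrict (Ioo a b)) :=
  edgeLp a b (expFun σ μ a s) (continuous_expFun σ μ a s)

lemma hasWeakDeriv_expEdge (hS' : S * Sᴴ = 1) (hμ : ∀ k, μ k ≠ 0) (σ : ℝ) {a b : ℝ} (hab : a < b)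
    (k : ι) :
    HasWeakDeriv a b
      (fun t => (spectralMatrix S μ).toEuclideanLin (expEdge σ (μ k) a b (rowVec S k) t))
      ((-σ : ℂ) • expEdge σ (μ k) a b (rowVec S k) : Lp _ _ _) := by
  have hμk : (μ k : ℂ) ≠ 0 := Complex.ofReal_ne_zero.2 (hμ k)
  have he : ∀ t, (spectralMatrix S μ).toEuclideanLin
      ((-σ / μ k : ℂ) • expFun σ (μ k) a (rowVec S k) t) =
        (-σ : ℂ) • expFun σ (μ k) a (rowVec S k) t := by
    intro t
    rw [map_smul, expFun, map_smul, spectralMatrix_rowVec hS', smul_smul, smul_smul, smul_smul]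
    congr 1
    field_simp
  have hc : Continuous fun t => (spectralMatrix S μ).toEuclideanLin
      ((-σ / μ k : ℂ) • expFun σ (μ k) a (rowVec S k) t) := by
    simp only [he]
    exact (continuous_expFun σ (μ k) a (rowVec S k)).const_smul (-σ : ℂ)
  have h := hasWeakDeriv_edgeLp (P := spectralMatrix S μ) hab
    (continuous_expFun σ (μ k) a (rowVec S k)) hc
    (hasDerivAt_expFun σ (μ k) a (rowVec S k))
  have hy : edgeLp a b _ hc = (-σ : ℂ) • expEdge σ (μ k) a b (rowVec S k) := by
    apply Lp.ext
    filter_upwards [coeFn_edgeLp (a := a) (b := b) hc,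
      coeFn_edgeLp (a := a) (b := b) (continuous_expFun σ (μ k) a (rowVec S k)),
      Lp.coeFn_smul (-σ : ℂ) (expEdge σ (μ k) a b (rowVec S k))] with t h1 h2 h3
    rw [h1, h3, he, Pi.smul_apply, expEdge, h2]
  rw [← hy]
  exact h

/-- Solutions of `(P x)' = -σ x` are combinations of exponentials. -/
lemma eq_exp_of_hasWeakDeriv (hS : Sᴴ * S = 1) (hS' : S * Sᴴ = 1) (hμ : ∀ k, μ k ≠ 0)
    {σ a b : ℝ} (hab : a < b)
    {x : Lp (EuclideanSpace ℂ (Fin d)) 2 (volume.restrict (Ioo a b))}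
    (h : HasWeakDeriv a b (fun t => (spectralMatrix S μ).toEuclideanLin (x t))
      ((-σ : ℂ) • x : Lp _ _ _)) :
    ∃ c : ι → ℂ, ∀ᵐ t ∂(volume.restrict (Ioo a b)), ∀ k,
      (S *ᵥ (x t).ofLp) k = c k * (Real.exp (-(σ * (t - a) / μ k)) : ℂ) := by
  obtain ⟨u, hu, hup⟩ := exists_contRep_of_hasWeakDeriv hab (spectralMatrix_mul_inv hS hS' hμ) h
  have hup' : IsPrimitiveOn a b (fun t => (spectralMatrix S μ).toEuclideanLin (u t))
      (fun t => (-σ : ℂ) • u t) := by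
    refine hup.congr_ae ?_
    filter_upwards [hu.2, Lp.coeFn_smul (-σ : ℂ) x] with t h1 h2
    rw [h2, Pi.smul_apply, h1]
  have hui : IntegrableOn u (Icc a b) := hu.1.integrableOn_Icc
  refine ⟨fun k => ⟪rowVec S k, u a⟫_ℂ, ?_⟩
  have key : ∀ k, ∀ t ∈ Icc a b, ⟪rowVec S k, u t⟫_ℂ =
      ⟪rowVec S k, u a⟫_ℂ * (Real.exp (-(σ * (t - a) / μ k)) : ℂ) := by
    intro k t ht
    have hμk : (μ k : ℂ) ≠ 0 := Complex.ofReal_ne_zero.2 (hμ k)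
    set z : ℝ → ℂ := fun t => ⟪rowVec S k, u t⟫_ℂ with hz
    have hzi : IntegrableOn z (Icc a b) := (innerSL ℂ (rowVec S k)).integrable_comp hui
    -- In the eigendirection `k` the system decouples into the scalar equation `μ_k z' = -σ z`.
    have hzp : IsPrimitiveOn a t z (fun s => (-σ / μ k : ℂ) * z s) := by
      intro r hr
      have hrb : r ∈ Icc a b := ⟨hr.1, hr.2.trans ht.2⟩
      have hir : IntervalIntegrable (fun s => (-σ : ℂ) • u s) volume a r := by
        rw [intervalIntegrable_iff_integrableOn_Ioc_of_le hr.1]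
        exact (hui.mono_set (Ioc_subset_Icc_self.trans (Icc_subset_Icc_right hrb.2))).smul (-σ : ℂ)
      have h1 := congrArg (fun v => ⟪rowVec S k, v⟫_ℂ) (hup' r hrb)
      simp only at h1
      rw [inner_add_right, inner_rowVec_spectralMatrix hS', inner_rowVec_spectralMatrix hS'] at h1
      have h2 : ⟪rowVec S k, ∫ s in a..r, (-σ : ℂ) • u s⟫_ℂ = ∫ s in a..r, (-σ : ℂ) * z s := by
        have := (innerSL ℂ (rowVec S k)).intervalIntegral_comp_comm hir
        simp only [innerSL_apply_apply, inner_smul_right] at this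
        exact this.symm
      rw [h2, intervalIntegral.integral_const_mul] at h1
      change z r = z a + _
      rw [intervalIntegral.integral_const_mul]
      change (μ k : ℂ) * z r = (μ k : ℂ) * z a + _ at h1
      refine mul_left_cancel₀ hμk ?_
      rw [h1]
      field_simp
    -- Integrating factor: the two integrals in the integration by parts of `F z` cancel, so `F t z
    -- t = F a z a = z a`.
    let F : ℝ → ℝ := fun s => Real.exp (σ * (s - a) / μ k)
    have hFd : ∀ s, HasDerivAt F (F s * (σ * 1 / μ k)) s := fun s =>
      ((((hasDerivAt_id s).sub_const a).const_mul σ).div_const (μ k)).exp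
    have hFc : Continuous fun s => F s * (σ * 1 / μ k) := by
      simp only [F]
      fun_prop
    have hF : IsPrimitiveOn a t F fun s => F s * (σ * 1 / μ k) :=
      isPrimitiveOn_of_hasDerivAt hFc hFd
    have hibp := hF.integral_bilin (ContinuousLinearMap.lsmul ℝ ℝ : ℝ →L[ℝ] ℂ →L[ℝ] ℂ) ht.1
      (hFc.integrableOn_Icc.mono_set Ioo_subset_Icc_self)
      ((hzi.mono_set (Ioo_subset_Icc_self.trans (Icc_subset_Icc_right ht.2))).const_mul _) hzp
    have hcancel : ∀ s, (ContinuousLinearMap.lsmul ℝ ℝ : ℝ →L[ℝ] ℂ →L[ℝ] ℂ) (F s)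
        ((-σ / μ k : ℂ) * z s) =
        -(ContinuousLinearMap.lsmul ℝ ℝ : ℝ →L[ℝ] ℂ →L[ℝ] ℂ) (F s * (σ * 1 / μ k)) (z s) := by
      intro s
      simp only [ContinuousLinearMap.lsmul_apply, Complex.real_smul]
      push_cast
      ring
    simp only [hcancel] at hibp
    rw [integral_neg, add_neg_cancel, eq_comm, sub_eq_zero] at hibp
    simp only [ContinuousLinearMap.lsmul_apply, Complex.real_smul, F, sub_self, mul_zero,
      zero_div, Real.exp_zero, Complex.ofReal_one, one_mul] at hibp
    change z t = z a * _
    rw [← hibp, Real.exp_neg, Complex.ofReal_inv, mul_comm, inv_mul_cancel_left₀]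
    exact Complex.ofReal_ne_zero.2 (Real.exp_ne_zero _)
  filter_upwards [hu.2, ae_restrict_mem measurableSet_Ioo] with t h1 h2 k
  rw [h1, ← inner_rowVec]
  exact key k t (Ioo_subset_Icc_self h2)

end Exponential

/-! ### The deficiency spaces -/

section UnitaryCopy

open scoped InnerProductSpace LinearPMap

variable {E : Type*} {d : ℕ} {ι : Type*} {S : Matrix ι (Fin d) ℂ}
  {μ : ι → ℝ} {a b : E → ℝ} {σ : ℝ}

open scoped Classical in
/-- The normalized exponential on the edge `e` in the `k`-th eigendirection. -/
noncomputable def expVec (S : Matrix ι (Fin d) ℂ) (μ : ι → ℝ) (a b : E → ℝ) (σ : ℝ) (i : E × ι) :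
    NetL2 d a b :=
  lp.single 2 i.1 (((expNorm σ (μ i.2) (b i.1 - a i.1))⁻¹ : ℂ) •
    expEdge σ (μ i.2) (a i.1) (b i.1) (rowVec S i.2))

/-- The coordinates of `x` with respect to the eigenbasis are the exponentials with
coefficients `c`. -/
def HasExpCoeff (S : Matrix ι (Fin d) ℂ) (μ : ι → ℝ) (σ : ℝ) (x : NetL2 d a b)
    (c : E → ι → ℂ) : Prop :=
  ∀ e, ∀ᵐ t ∂(volume.restrict (Ioo (a e) (b e))), ∀ k,
    (S *ᵥ (x e t).ofLp) k = c e k * (Real.exp (-(σ * (t - a e) / μ k)) : ℂ)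

/-- The normalization contributes `expNorm⁻¹` and the integral `expNorm²`. The remaining factor is
the source of the quotient of norms in `IsUnitaryCopy`. -/
lemma inner_expVec (hab : ∀ e, a e < b e) (hμ : ∀ k, μ k ≠ 0) (hσ : σ ^ 2 = 1)
    {x : NetL2 d a b} {c : E → ι → ℂ} (hx : HasExpCoeff S μ σ x c) (i : E × ι) :
    ⟪expVec S μ a b σ i, x⟫_ℂ = expNorm σ (μ i.2) (b i.1 - a i.1) * c i.1 i.2 := by
  classical
  obtain ⟨e, k⟩ := i
  have hσ0 : σ ≠ 0 := by
    rintro rfl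
    norm_num at hσ
  have hN := expNorm_pos hσ0 (hμ k) (sub_pos.2 (hab e))
  simp only
  rw [expVec, lp.inner_single_left, inner_smul_left, inner_edge]
  have h : ∫ t in Ioo (a e) (b e), ⟪expEdge σ (μ k) (a e) (b e) (rowVec S k) t, x e t⟫_ℂ =
      ∫ t in Ioo (a e) (b e), ((Real.exp (-(σ * (t - a e) / μ k)) ^ 2 : ℝ) : ℂ) * c e k := by
    refine integral_congr_ae ?_
    filter_upwards [hx e, coeFn_edgeLp (a := a e) (b := b e)
      (continuous_expFun σ (μ k) (a e) (rowVec S k))] with t h1 h2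
    rw [expEdge, h2, expFun, inner_smul_left, inner_rowVec, h1, Complex.conj_ofReal]
    push_cast
    ring
  rw [h, integral_mul_const, integral_complex_ofReal, integral_exp_sq hσ (hμ k) (hab e)]
  have hN' : (expNorm σ (μ k) (b e - a e) : ℂ) ≠ 0 := Complex.ofReal_ne_zero.2 hN.ne'
  rw [map_inv₀, Complex.conj_ofReal]
  push_cast
  field_simp

lemma IsMaxPair.smul {P Q : Matrix (Fin d) (Fin d) ℂ} (hab : ∀ e, a e < b e) (hP : P.IsHermitian)
    (hPQ : P * Q = 1) {x y : NetL2 d a b} (h : IsMaxPair P x y) (c : ℂ) :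
    IsMaxPair P (c • x) (c • y) := by
  have h' : (x, -y) ∈ ((netOp P a b)†).graph := by
    rwa [mem_netOp_adjoint_graph hab hP hPQ, neg_neg]
  have := ((netOp P a b)†).graph.smul_mem c h'
  rwa [Prod.smul_mk, mem_netOp_adjoint_graph hab hP hPQ, smul_neg, neg_neg] at this

variable [DecidableEq ι]

open scoped Classical in
lemma hasExpCoeff_expVec (hS' : S * Sᴴ = 1) (i : E × ι) :
    HasExpCoeff S μ σ (expVec S μ a b σ i) fun e k =>
      if (e, k) = i then ((expNorm σ (μ i.2) (b i.1 - a i.1))⁻¹ : ℂ) else 0 := by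
  obtain ⟨e', k'⟩ := i
  intro e
  simp only [Prod.mk.injEq]
  by_cases he : e = e'
  · subst he
    rw [expVec]
    simp only
    rw [lp.single_apply_self]
    filter_upwards [Lp.coeFn_smul ((expNorm σ (μ k') (b e - a e))⁻¹ : ℂ)
        (expEdge σ (μ k') (a e) (b e) (rowVec S k')),
      coeFn_edgeLp (a := a e) (b := b e)
        (continuous_expFun σ (μ k') (a e) (rowVec S k'))] with t h1 h2 k
    rw [h1, Pi.smul_apply, expEdge, h2, ← inner_rowVec, inner_smul_right, expFun, inner_smul_right,
      inner_rowVec_rowVec hS']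
    by_cases hk : k = k'
    · simp [hk]
    · simp [hk]
  · rw [expVec]
    simp only
    rw [lp.single_apply_ne _ _ _ he]
    filter_upwards [Lp.coeFn_zero (EuclideanSpace ℂ (Fin d)) 2
      (volume.restrict (Ioo (a e) (b e)))] with t ht k
    rw [ht]
    simp [he]

lemma orthonormal_expVec (hS' : S * Sᴴ = 1) (hab : ∀ e, a e < b e) (hμ : ∀ k, μ k ≠ 0)
    (hσ : σ ^ 2 = 1) : Orthonormal ℂ (expVec S μ a b σ) := by
  classical
  rw [orthonormal_iff_ite]
  intro i j
  rw [inner_expVec hab hμ hσ (hasExpCoeff_expVec hS' j)]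
  by_cases hij : i = j
  · subst hij
    have hσ0 : σ ≠ 0 := by
      rintro rfl
      norm_num at hσ
    have hN := expNorm_pos hσ0 (hμ i.2) (sub_pos.2 (hab i.1))
    have hN' : (expNorm σ (μ i.2) (b i.1 - a i.1) : ℂ) ≠ 0 := Complex.ofReal_ne_zero.2 hN.ne'
    simp [hN']
  · simp [hij]

variable [Fintype ι]

lemma isMaxPair_expVec (hS : Sᴴ * S = 1) (hS' : S * Sᴴ = 1) (hab : ∀ e, a e < b e) (hμ : ∀ k, μ k ≠ 0) (i : E × ι) :
    IsMaxPair (spectralMatrix S μ) (expVec S μ a b σ i) ((-σ : ℂ) • expVec S μ a b σ i) := by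
  classical
  have h := isMaxPair_single (a := a) (b := b)
    (hasWeakDeriv_expEdge hS' hμ σ (hab i.1) i.2)
  have h' := h.smul hab isHermitian_spectralMatrix (spectralMatrix_mul_inv hS hS' hμ)
    ((expNorm σ (μ i.2) (b i.1 - a i.1))⁻¹ : ℂ)
  rwa [lp.single_smul, smul_comm, ← lp.single_smul] at h'

variable {K : Submodule ℂ (NetL2 d a b)}
  (hK : ∀ x, x ∈ K ↔ IsMaxPair (spectralMatrix S μ) x ((-σ : ℂ) • x))

include hK

lemma exists_hasExpCoeff (hS : Sᴴ * S = 1) (hS' : S * Sᴴ = 1) (hab : ∀ e, a e < b e)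
    (hμ : ∀ k, μ k ≠ 0) {x : NetL2 d a b} (hx : x ∈ K) : ∃ c, HasExpCoeff S μ σ x c := by
  choose c hc using fun e => eq_exp_of_hasWeakDeriv hS hS' hμ (hab e) ((hK x).1 hx e)
  exact ⟨c, hc⟩

/-- The normalized exponentials form a Hilbert basis of the space of solutions of
`(P x)' = -σ x`. -/
lemma exists_expBasis [CompleteSpace K] (hS : Sᴴ * S = 1) (hS' : S * Sᴴ = 1)
    (hab : ∀ e, a e < b e) (hμ : ∀ k, μ k ≠ 0) (hσ : σ ^ 2 = 1) :
    ∃ B : HilbertBasis (E × ι) ℂ K, ∀ i, (B i : NetL2 d a b) = expVec S μ a b σ i := by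
  have hσ0 : σ ≠ 0 := by
    rintro rfl
    norm_num at hσ
  let v : E × ι → K := fun i => ⟨expVec S μ a b σ i, (hK _).2 (isMaxPair_expVec hS hS' hab hμ i)⟩
  have hv : Orthonormal ℂ v :=
    (K.subtypeₗᵢ.orthonormal_comp_iff (v := v)).1 (orthonormal_expVec hS' hab hμ hσ)
  -- Completeness: a solution is determined by its exponential coefficients, and orthogonality to
  -- all basis vectors annihilates them.
  have hbot : (Submodule.span ℂ (Set.range v))ᗮ = ⊥ := by
    rw [Submodule.eq_bot_iff]
    rintro ⟨x, hx⟩ hx'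
    obtain ⟨c, hc⟩ := exists_hasExpCoeff hK hS hS' hab hμ hx
    have hc0 : ∀ e k, c e k = 0 := by
      intro e k
      have h1 : ⟪expVec S μ a b σ (e, k), x⟫_ℂ = 0 :=
        (Submodule.mem_orthogonal _ _).1 hx' (v (e, k)) (Submodule.subset_span ⟨_, rfl⟩)
      rw [inner_expVec hab hμ hσ hc] at h1
      exact (mul_eq_zero.1 h1).resolve_left (Complex.ofReal_ne_zero.2
        (expNorm_pos hσ0 (hμ k) (sub_pos.2 (hab e))).ne')
    apply Subtype.ext
    ext1
    funext e
    apply Lp.ext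
    filter_upwards [hc e, Lp.coeFn_zero (EuclideanSpace ℂ (Fin d)) 2
      (volume.restrict (Ioo (a e) (b e)))] with t h1 h2
    refine (eq_zero_of_inner_rowVec hS fun k => ?_).trans h2.symm
    rw [inner_rowVec, h1, hc0, zero_mul]
  refine ⟨HilbertBasis.mkOfOrthogonalEqBot hv hbot, fun i => ?_⟩
  rw [HilbertBasis.coe_mkOfOrthogonalEqBot]

/-- The canonical unitary map between the deficiency spaces. -/
lemma exists_unitaryCopy [CompleteSpace K] (hS : Sᴴ * S = 1) (hS' : S * Sᴴ = 1)
    (hab : ∀ e, a e < b e) (hμ : ∀ k, μ k ≠ 0) (hσ : σ ^ 2 = 1)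
    {K' : Submodule ℂ (NetL2 d (fun _ : E => 0) (fun _ : E => 1))} [CompleteSpace K']
    (hK' : ∀ x, x ∈ K' ↔ IsMaxPair (spectralMatrix S μ) x ((-σ : ℂ) • x)) :
    ∃ U : K ≃ₗᵢ[ℂ] K', ∀ (x : K) (y : K'), IsUnitaryCopy S μ a b σ (x : NetL2 d a b) y ↔ y = U x := by
  have hσ0 : σ ≠ 0 := by
    rintro rfl
    norm_num at hσ
  obtain ⟨B, hB⟩ := exists_expBasis hK hS hS' hab hμ hσ
  obtain ⟨B', hB'⟩ := exists_expBasis hK' hS hS' (fun _ => zero_lt_one) hμ hσ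
  have hN : ∀ e k, (expNorm σ (μ k) (b e - a e) : ℂ) ≠ 0 := fun e k =>
    Complex.ofReal_ne_zero.2 (expNorm_pos hσ0 (hμ k) (sub_pos.2 (hab e))).ne'
  have hN' : ∀ k, (expNorm σ (μ k) 1 : ℂ) ≠ 0 := fun k =>
    Complex.ofReal_ne_zero.2 (expNorm_pos hσ0 (hμ k) one_pos).ne'
  have hr : ∀ (x : K) (c), HasExpCoeff S μ σ (x : NetL2 d a b) c → ∀ i,
      B.repr x i = expNorm σ (μ i.2) (b i.1 - a i.1) * c i.1 i.2 := fun x c hc i => by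
    rw [B.repr_apply_apply, Submodule.coe_inner, hB, inner_expVec hab hμ hσ hc]
  have hr' : ∀ (x : K') (c), HasExpCoeff S μ σ (x : NetL2 d (fun _ : E => 0) (fun _ : E => 1)) c → ∀ i,
      B'.repr x i = expNorm σ (μ i.2) 1 * c i.1 i.2 := fun x c hc i => by
    rw [B'.repr_apply_apply, Submodule.coe_inner, hB', inner_expVec (fun _ => zero_lt_one) hμ hσ hc,
      sub_zero]
  -- The unitary sends each normalized exponential to its counterpart on the unit interval. Equality
  -- of the coordinates `expNorm * c` on both sides is the relation between coefficients in
  -- `IsUnitaryCopy`.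
  refine ⟨B.repr.trans B'.repr.symm, fun x y => ?_⟩
  rw [LinearIsometryEquiv.trans_apply, LinearIsometryEquiv.eq_symm_apply]
  constructor
  · rintro ⟨c, hc⟩
    have h1 : HasExpCoeff S μ σ (x : NetL2 d a b) c := fun e => (hc e).1
    have h2 : HasExpCoeff S μ σ (y : NetL2 d (fun _ : E => 0) (fun _ : E => 1)) fun e k =>
        (expNorm σ (μ k) (b e - a e) / expNorm σ (μ k) 1 : ℝ) * c e k := fun e => by
      simpa only [sub_zero] using (hc e).2
    ext i
    rw [hr x _ h1, hr' y _ h2]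
    have := hN' i.2
    push_cast
    field_simp
  · intro h
    obtain ⟨c, hc⟩ := exists_hasExpCoeff hK hS hS' hab hμ x.2
    obtain ⟨c', hc'⟩ := exists_hasExpCoeff hK' hS hS' (fun _ => zero_lt_one) hμ y.2
    refine ⟨c, fun e => ⟨hc e, ?_⟩⟩
    filter_upwards [hc' e] with t ht k
    rw [ht, sub_zero]
    congr 1
    have h1 := hr' y c' hc' (e, k)
    rw [h, hr x c hc] at h1
    simp only at h1
    have := hN' k
    push_cast
    field_simp
    linear_combination -h1

end UnitaryCopy

/-! ### Boundary values -/

section Components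

open scoped InnerProductSpace

instance {n : ℕ} (w : Fin n → Ioi (0 : ℝ)) : FiniteDimensional ℂ (WSpace w) :=
  inferInstanceAs (FiniteDimensional ℂ (Fin n → ℂ))

instance {n : ℕ} (w : Fin n → Ioi (0 : ℝ)) : CompleteSpace (WSpace w) :=
  FiniteDimensional.complete ℂ _

variable {d n np nm : ℕ} {ι : Type*}

/-- The components `(S v)_{f k}` of `S v`. -/
noncomputable def component (S : Matrix ι (Fin d) ℂ) (f : Fin n → ι) (w : Fin n → Ioi (0 : ℝ)) :
    EuclideanSpace ℂ (Fin d) →ₗ[ℂ] WSpace w where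
  toFun v := fun k => (S *ᵥ v.ofLp) (f k)
  map_add' v v' := by
    funext k
    exact congrFun (mulVec_add S v.ofLp v'.ofLp) (f k)
  map_smul' c v := by
    funext k
    exact congrFun (mulVec_smul S c v.ofLp) (f k)

lemma component_apply (S : Matrix ι (Fin d) ℂ) (f : Fin n → ι) (w : Fin n → Ioi (0 : ℝ))
    (v : EuclideanSpace ℂ (Fin d)) (k : Fin n) : component S f w v k = (S *ᵥ v.ofLp) (f k) := rfl

lemma norm_sq_component (S : Matrix ι (Fin d) ℂ) (f : Fin n → ι) (w : Fin n → Ioi (0 : ℝ))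
    (v : EuclideanSpace ℂ (Fin d)) :
    ((‖component S f w v‖ ^ 2 : ℝ) : ℂ) =
      ∑ k, ((w k : ℝ) : ℂ) * (star ((S *ᵥ v.ofLp) (f k)) * (S *ᵥ v.ofLp) (f k)) := by
  rw [Complex.ofReal_pow]
  exact (inner_self_eq_norm_sq_to_K (𝕜 := ℂ) (component S f w v)).symm

variable (S : Matrix (Fin np ⊕ Fin nm) (Fin d) ℂ) (lam : Fin np → Ioi (0 : ℝ))
  (theta : Fin nm → Ioi (0 : ℝ))

/-- In the coordinates `S v` the form is diagonal with entries `λ_k` and `-θ_k`; the weights of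
`WSpace` absorb them. -/
lemma re_inner_spectralMatrix (v : EuclideanSpace ℂ (Fin d)) :
    (⟪v, (spectralMatrix S (signedDiag lam theta)).toEuclideanLin v⟫_ℂ).re =
      ‖component S Sum.inl lam v‖ ^ 2 - ‖component S Sum.inr theta v‖ ^ 2 := by
  rw [← Complex.ofReal_re (‖component S Sum.inl lam v‖ ^ 2 - _), Complex.ofReal_sub,
    norm_sq_component, norm_sq_component]
  congr 1
  rw [EuclideanSpace.inner_eq_star_dotProduct]
  change (spectralMatrix S (signedDiag lam theta) *ᵥ v.ofLp) ⬝ᵥ star v.ofLp = _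
  rw [spectralMatrix, ← mulVec_mulVec, ← mulVec_mulVec, dotProduct_comm, dotProduct_mulVec,
    ← star_mulVec]
  simp only [dotProduct, mulVec_diagonal, Fintype.sum_sum_type, signedDiag, Sum.elim_inl,
    Sum.elim_inr, Pi.star_apply, Complex.ofReal_neg]
  rw [sub_eq_add_neg, ← Finset.sum_neg_distrib]
  congr 1 <;> exact Finset.sum_congr rfl fun k _ => by ring

/-- The vector with given components. -/
noncomputable def liftComponents :
    WSpace lam × WSpace theta →ₗ[ℂ] EuclideanSpace ℂ (Fin d) where
  toFun g := WithLp.toLp 2 (Sᴴ *ᵥ Sum.elim g.1 g.2)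
  map_add' g h := by
    rw [← WithLp.toLp_add, ← mulVec_add]
    congr 2
    ext (k | k) <;> rfl
  map_smul' c g := by
    rw [RingHom.id_apply, ← WithLp.toLp_smul, ← mulVec_smul]
    congr 2
    ext (k | k) <;> rfl

variable {S lam theta}

lemma mulVec_liftComponents (hS' : S * Sᴴ = 1) (g : WSpace lam × WSpace theta) :
    S *ᵥ (liftComponents S lam theta g).ofLp = Sum.elim g.1 g.2 := by
  change S *ᵥ (Sᴴ *ᵥ Sum.elim g.1 g.2) = _
  rw [mulVec_mulVec, hS', one_mulVec]

lemma component_inl_lift (hS' : S * Sᴴ = 1) (g : WSpace lam × WSpace theta) :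
    component S Sum.inl lam (liftComponents S lam theta g) = g.1 := by
  funext k
  rw [component_apply, mulVec_liftComponents hS']
  rfl

lemma component_inr_lift (hS' : S * Sᴴ = 1) (g : WSpace lam × WSpace theta) :
    component S Sum.inr theta (liftComponents S lam theta g) = g.2 := by
  funext k
  rw [component_apply, mulVec_liftComponents hS']
  rfl

end Components

/-! ### Affine functions on the unit interval -/

section Affine

open scoped InnerProductSpace

variable {d : ℕ} {P Q : Matrix (Fin d) (Fin d) ℂ}

/-- The affine function with values `v` at `0` and `w` at `1`. -/
noncomputable def affineFun (v w : EuclideanSpace ℂ (Fin d)) (t : ℝ) : EuclideanSpace ℂ (Fin d) :=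
  v + t • (w - v)

lemma continuous_affineFun (v w : EuclideanSpace ℂ (Fin d)) : Continuous (affineFun v w) := by
  unfold affineFun
  fun_prop

lemma hasDerivAt_affineFun (v w : EuclideanSpace ℂ (Fin d)) (t : ℝ) :
    HasDerivAt (affineFun v w) (w - v) t :=
  (((hasDerivAt_id' t).smul_const (w - v)).const_add v).congr_deriv (one_smul ℝ _)

/-- The unit interval has measure one, so no length factor appears. -/
lemma norm_edgeLp_le {u : ℝ → EuclideanSpace ℂ (Fin d)} (hu : Continuous u) {C : ℝ} (hC : 0 ≤ C)
    (h : ∀ t ∈ Ioo (0 : ℝ) 1, ‖u t‖ ≤ C) : ‖edgeLp 0 1 u hu‖ ≤ C := by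
  have := Lp.norm_le_of_ae_bound (f := edgeLp 0 1 u hu) hC (by
    filter_upwards [coeFn_edgeLp (a := 0) (b := 1) hu, ae_restrict_mem measurableSet_Ioo]
      with t h1 h2
    rw [h1]
    exact h t h2)
  simpa [measureUnivNNReal] using this

/-- The class in `L²(0, 1)` of an affine function. -/
noncomputable def affineEdge (v w : EuclideanSpace ℂ (Fin d)) :
    Lp (EuclideanSpace ℂ (Fin d)) 2 (volume.restrict (Ioo (0 : ℝ) 1)) :=
  edgeLp 0 1 (affineFun v w) (continuous_affineFun v w)

/-- The derivative of an affine function, multiplied by `P`. -/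
noncomputable def affineEdgeDeriv (P : Matrix (Fin d) (Fin d) ℂ) (v w : EuclideanSpace ℂ (Fin d)) :
    Lp (EuclideanSpace ℂ (Fin d)) 2 (volume.restrict (Ioo (0 : ℝ) 1)) :=
  edgeLp 0 1 (fun _ => P.toEuclideanLin (w - v)) continuous_const

lemma hasWeakDeriv_affineEdge (v w : EuclideanSpace ℂ (Fin d)) :
    HasWeakDeriv 0 1 (fun t => P.toEuclideanLin (affineEdge v w t)) (affineEdgeDeriv P v w) :=
  hasWeakDeriv_edgeLp zero_lt_one _ continuous_const (hasDerivAt_affineFun v w)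

lemma isContRep_affineEdge (v w : EuclideanSpace ℂ (Fin d)) :
    IsContRep 0 1 (affineEdge v w) (affineFun v w) := isContRep_edgeLp _

lemma norm_affineEdge_le (v w : EuclideanSpace ℂ (Fin d)) : ‖affineEdge v w‖ ≤ ‖v‖ + ‖w‖ := by
  refine norm_edgeLp_le _ (by positivity) fun t ht => ?_
  have : affineFun v w t = (1 - t) • v + t • w := by
    rw [affineFun, smul_sub, sub_smul, one_smul]
    abel
  rw [this]
  refine (norm_add_le _ _).trans (add_le_add ?_ ?_)
  · rw [norm_smul, Real.norm_of_nonneg (by linarith [ht.2])]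
    exact mul_le_of_le_one_left (norm_nonneg _) (by linarith [ht.1])
  · rw [norm_smul, Real.norm_of_nonneg ht.1.le]
    exact mul_le_of_le_one_left (norm_nonneg _) ht.2.le

lemma norm_affineEdgeDeriv_le (v w : EuclideanSpace ℂ (Fin d)) : ‖affineEdgeDeriv P v w‖ ≤
    ‖LinearMap.toContinuousLinearMap P.toEuclideanLin‖ * (‖v‖ + ‖w‖) := by
  refine norm_edgeLp_le _ (by positivity) fun t _ => ?_
  refine ((LinearMap.toContinuousLinearMap P.toEuclideanLin).le_opNorm _).trans ?_
  gcongr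
  rw [add_comm]
  exact norm_sub_le _ _

/-- Here `r`, `s` stand for the norms of the boundary values, `X`, `Y` for those of `x` and `y`, and
`A`, `B` for those of the affine test function and its image. The estimate follows from `(r + s)² ≤
2 (r² + s²)` on dividing by `r + s`. -/
lemma trace_bound_aux {p q X Y A B r s : ℝ} (hp : 0 ≤ p) (hX : 0 ≤ X) (hY : 0 ≤ Y) (hr : 0 ≤ r)
    (hs : 0 ≤ s) (h : s ^ 2 + r ^ 2 ≤ Y * A + X * B) (hA : A ≤ q * (r + s))
    (hB : B ≤ p * (q * (r + s))) (hq : 0 ≤ q) :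
    r + s ≤ 2 * ((1 + p) * q) * (X + Y) := by
  have k1 : Y * A ≤ Y * (q * (r + s)) := mul_le_mul_of_nonneg_left hA hY
  have k2 : X * B ≤ X * (p * (q * (r + s))) := mul_le_mul_of_nonneg_left hB hX
  have k3 : (r + s) * (r + s) ≤ 2 * (s ^ 2 + r ^ 2) := by linarith [sq_nonneg (r - s)]
  have k4 : 0 ≤ X * (q * (r + s)) := by positivity
  have k5 : 0 ≤ Y * (p * (q * (r + s))) := by positivity
  have hmain : (r + s) * (r + s) ≤ (2 * ((1 + p) * q) * (X + Y)) * (r + s) := by linarith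
  rcases (add_nonneg hr hs).eq_or_lt with h0 | h0
  · rw [← h0]
    positivity
  · exact le_of_mul_le_mul_right hmain h0

/-- Boundary values are controlled by the graph norm. -/
lemma exists_trace_bound (hP : P.IsHermitian) (hPQ : P * Q = 1) :
    ∃ C : ℝ, ∀ (x y : Lp (EuclideanSpace ℂ (Fin d)) 2 (volume.restrict (Ioo (0 : ℝ) 1)))
      (u : ℝ → EuclideanSpace ℂ (Fin d)),
      HasWeakDeriv 0 1 (fun t => P.toEuclideanLin (x t)) y → IsContRep 0 1 x u →
        ‖u 0‖ + ‖u 1‖ ≤ C * (‖x‖ + ‖y‖) := by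
  set p := ‖LinearMap.toContinuousLinearMap P.toEuclideanLin‖ with hp
  set q := ‖LinearMap.toContinuousLinearMap Q.toEuclideanLin‖ with hq
  have hp0 : 0 ≤ p := norm_nonneg _
  have hq0 : 0 ≤ q := norm_nonneg _
  refine ⟨2 * ((1 + p) * q), fun x y u h hu => ?_⟩
  -- These endpoint values of the affine test function turn the boundary term of Green's identity
  -- into `‖u 1‖² + ‖u 0‖²`.
  set v := -Q.toEuclideanLin (u 0) with hv
  set w := Q.toEuclideanLin (u 1) with hw
  have hvw : ‖v‖ + ‖w‖ ≤ q * (‖u 0‖ + ‖u 1‖) := by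
    rw [hv, norm_neg, mul_add]
    exact add_le_add ((LinearMap.toContinuousLinearMap Q.toEuclideanLin).le_opNorm _)
      ((LinearMap.toContinuousLinearMap Q.toEuclideanLin).le_opNorm _)
  have hg := edge_green zero_lt_one hP hPQ hu (isContRep_affineEdge v w)
    (hu.isPrimitiveOn zero_lt_one hPQ h)
    ((isContRep_affineEdge v w).isPrimitiveOn zero_lt_one hPQ (hasWeakDeriv_affineEdge v w))
  have h0 : affineFun v w 0 = v := by simp [affineFun]
  have h1 : affineFun v w 1 = w := by simp [affineFun]
  rw [h0, h1, hv, hw, map_neg, toEuclideanLin_apply_apply hPQ, toEuclideanLin_apply_apply hPQ,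
    inner_neg_right, sub_neg_eq_add, inner_self_eq_norm_sq_to_K, inner_self_eq_norm_sq_to_K,
    ← hv, ← hw] at hg
  have hn : ‖u 1‖ ^ 2 + ‖u 0‖ ^ 2 ≤ ‖y‖ * ‖affineEdge v w‖ + ‖x‖ * ‖affineEdgeDeriv P v w‖ := by
    have e1 : ‖(((‖u 1‖ : ℝ) : ℂ) ^ 2 + ((‖u 0‖ : ℝ) : ℂ) ^ 2)‖ = ‖u 1‖ ^ 2 + ‖u 0‖ ^ 2 := by
      rw [← Complex.ofReal_pow, ← Complex.ofReal_pow, ← Complex.ofReal_add, Complex.norm_real,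
        Real.norm_of_nonneg (by positivity)]
    have e2 := congrArg norm hg
    rw [← e1]
    refine e2.symm.le.trans ((norm_add_le _ _).trans ?_)
    exact add_le_add (norm_inner_le_norm (𝕜 := ℂ) _ _) (norm_inner_le_norm (𝕜 := ℂ) _ _)
  have hA := norm_affineEdge_le v w
  have hB := norm_affineEdgeDeriv_le (P := P) v w
  rw [← hp] at hB
  exact trace_bound_aux hp0 (norm_nonneg _) (norm_nonneg _) (norm_nonneg _) (norm_nonneg _) hn
    (hA.trans hvw) (hB.trans (mul_le_mul_of_nonneg_left hvw hp0)) hq0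

end Affine

/-! ### The boundary pair given by the boundary values -/

section Traces

open scoped InnerProductSpace LinearPMap

variable {E : Type*} {d np nm : ℕ} {S : Matrix (Fin np ⊕ Fin nm) (Fin d) ℂ}
  {lam : Fin np → Ioi (0 : ℝ)} {theta : Fin nm → Ioi (0 : ℝ)}

lemma signedDiag_ne_zero (k : Fin np ⊕ Fin nm) : signedDiag lam theta k ≠ 0 := by
  rcases k with k | k
  · exact (lam k).2.ne'
  · exact neg_ne_zero.2 (theta k).2.ne'

lemma hasTraces_iff {x : NetL2 d (fun _ : E => 0) (fun _ : E => 1)} {g₁ : BdSpace E lam theta}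
    {g₂ : BdSpace E theta lam} :
    HasTraces S x g₁ g₂ ↔ ∀ e, ∃ u, IsContRep 0 1 (x e) u ∧
      g₁.fst e = component S Sum.inl lam (u 0) ∧ g₁.snd e = component S Sum.inr theta (u 1) ∧
      g₂.fst e = component S Sum.inr theta (u 0) ∧ g₂.snd e = component S Sum.inl lam (u 1) := by
  refine forall_congr' fun e => exists_congr fun u => and_congr_right fun _ => ?_
  exact and_congr funext_iff.symm (and_congr funext_iff.symm
    (and_congr funext_iff.symm funext_iff.symm))

/-- Uniqueness makes any choice of traces linear in `x`. -/
lemma HasTraces.unique {x : NetL2 d (fun _ : E => 0) (fun _ : E => 1)}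
    {g₁ g₁' : BdSpace E lam theta} {g₂ g₂' : BdSpace E theta lam} (h : HasTraces S x g₁ g₂)
    (h' : HasTraces S x g₁' g₂') : g₁ = g₁' ∧ g₂ = g₂' := by
  rw [hasTraces_iff] at h h'
  have key : ∀ e, (g₁.fst e = g₁'.fst e ∧ g₁.snd e = g₁'.snd e) ∧
      (g₂.fst e = g₂'.fst e ∧ g₂.snd e = g₂'.snd e) := by
    intro e
    obtain ⟨u, hu, h1, h2, h3, h4⟩ := h e
    obtain ⟨v, hv, k1, k2, k3, k4⟩ := h' e
    have huv := hu.eqOn zero_lt_one hv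
    have e0 := huv (left_mem_Icc.2 zero_le_one)
    have e1 := huv (right_mem_Icc.2 zero_le_one)
    rw [h1, h2, h3, h4, k1, k2, k3, k4, e0, e1]
    simp
  constructor
  · refine WithLp.ofLp_injective 2 (Prod.ext ?_ ?_)
    · ext1
      exact funext fun e => (key e).1.1
    · ext1
      exact funext fun e => (key e).1.2
  · refine WithLp.ofLp_injective 2 (Prod.ext ?_ ?_)
    · ext1
      exact funext fun e => (key e).2.1
    · ext1
      exact funext fun e => (key e).2.2

lemma HasTraces.add {x x' : NetL2 d (fun _ : E => 0) (fun _ : E => 1)}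
    {g₁ g₁' : BdSpace E lam theta} {g₂ g₂' : BdSpace E theta lam} (h : HasTraces S x g₁ g₂)
    (h' : HasTraces S x' g₁' g₂') : HasTraces S (x + x') (g₁ + g₁') (g₂ + g₂') := by
  rw [hasTraces_iff] at h h' ⊢
  intro e
  obtain ⟨u, hu, h1, h2, h3, h4⟩ := h e
  obtain ⟨v, hv, k1, k2, k3, k4⟩ := h' e
  refine ⟨u + v, ⟨hu.1.add hv.1, ?_⟩, ?_⟩
  · filter_upwards [hu.2, hv.2, Lp.coeFn_add (x e) (x' e)] with t a1 a2 a3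
    rw [Pi.add_apply, ← a1, ← a2]
    exact a3
  · simp only [Pi.add_apply, map_add, ← h1, ← h2, ← h3, ← h4, ← k1, ← k2, ← k3, ← k4]
    exact ⟨rfl, rfl, rfl, rfl⟩

lemma HasTraces.smul {x : NetL2 d (fun _ : E => 0) (fun _ : E => 1)}
    {g₁ : BdSpace E lam theta} {g₂ : BdSpace E theta lam} (h : HasTraces S x g₁ g₂) (c : ℂ) :
    HasTraces S (c • x) (c • g₁) (c • g₂) := by
  rw [hasTraces_iff] at h ⊢
  intro e
  obtain ⟨u, hu, h1, h2, h3, h4⟩ := h e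
  refine ⟨c • u, ⟨hu.1.const_smul c, ?_⟩, ?_⟩
  · filter_upwards [hu.2, Lp.coeFn_smul c (x e)] with t a1 a3
    rw [Pi.smul_apply, ← a1]
    exact a3
  · simp only [Pi.smul_apply, map_smul, ← h1, ← h2, ← h3, ← h4]
    exact ⟨rfl, rfl, rfl, rfl⟩

lemma memℓp_of_norm_le {F : E → Type*} [∀ e, NormedAddCommGroup (F e)] {G H : E → Type*}
    [∀ e, NormedAddCommGroup (G e)] [∀ e, NormedAddCommGroup (H e)]
    {f : ∀ e, F e} (x : lp G 2) (y : lp H 2) (C : ℝ) (h : ∀ e, ‖f e‖ ≤ C * (‖x e‖ + ‖y e‖)) :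
    Memℓp f 2 := by
  have h1 : Memℓp (fun e => ‖x e‖) 2 := memℓp_norm_iff.2 (lp.memℓp x)
  have h2 : Memℓp (fun e => ‖y e‖) 2 := memℓp_norm_iff.2 (lp.memℓp y)
  exact ((h1.add h2).const_mul C).mono h

/-- The constant in `exists_trace_bound` serves all edges at once, so square summability passes from
`x` and `y` to the traces. On arbitrarily short edges no common constant exists: a constant vector
`v` on an edge of length `ℓ` has norm `√ℓ ‖v‖` and derivative zero. -/
lemma exists_hasTraces (hS : Sᴴ * S = 1) (hS' : S * Sᴴ = 1)
    {x y : NetL2 d (fun _ : E => 0) (fun _ : E => 1)}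
    (h : IsMaxPair (spectralMatrix S (signedDiag lam theta)) x y) :
    ∃ (g₁ : BdSpace E lam theta) (g₂ : BdSpace E theta lam), HasTraces S x g₁ g₂ := by
  have hPQ := spectralMatrix_mul_inv (μ := signedDiag lam theta) hS hS' signedDiag_ne_zero
  obtain ⟨C, hC⟩ := exists_trace_bound (isHermitian_spectralMatrix (μ := signedDiag lam theta)) hPQ
  choose u hu _ using fun e => exists_contRep_of_hasWeakDeriv zero_lt_one hPQ (h e)
  have hb : ∀ e, ‖u e 0‖ + ‖u e 1‖ ≤ C * (‖x e‖ + ‖y e‖) := fun e =>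
    hC (x e) (y e) (u e) (h e) (hu e)
  have hm : ∀ {n : ℕ} (w : Fin n → Ioi (0 : ℝ)) (f : Fin n → Fin np ⊕ Fin nm)
      (r : E → ℝ), (∀ e, ‖u e (r e)‖ ≤ ‖u e 0‖ + ‖u e 1‖) →
      Memℓp (fun e => component S f w (u e (r e))) 2 := by
    intro n w f r hr
    set L := LinearMap.toContinuousLinearMap (component S f w)
    refine memℓp_of_norm_le x y (‖L‖ * C) fun e => ?_
    calc ‖L (u e (r e))‖ ≤ ‖L‖ * ‖u e (r e)‖ := L.le_opNorm _
      _ ≤ ‖L‖ * (C * (‖x e‖ + ‖y e‖)) :=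
        mul_le_mul_of_nonneg_left ((hr e).trans (hb e)) (norm_nonneg L)
      _ = _ := by ring
  have b0 : ∀ e, ‖u e 0‖ ≤ ‖u e 0‖ + ‖u e 1‖ := fun e => le_add_of_nonneg_right (norm_nonneg _)
  have b1 : ∀ e, ‖u e 1‖ ≤ ‖u e 0‖ + ‖u e 1‖ := fun e => le_add_of_nonneg_left (norm_nonneg _)
  refine ⟨WithLp.toLp 2 (⟨_, hm lam Sum.inl (fun _ => 0) b0⟩,
      ⟨_, hm theta Sum.inr (fun _ => 1) b1⟩),
    WithLp.toLp 2 (⟨_, hm theta Sum.inr (fun _ => 0) b0⟩,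
      ⟨_, hm lam Sum.inl (fun _ => 1) b1⟩), ?_⟩
  rw [hasTraces_iff]
  exact fun e => ⟨u e, hu e, rfl, rfl, rfl, rfl⟩

/-- Boundary values may be prescribed. -/
lemma exists_isMaxPair_hasTraces (hS' : S * Sᴴ = 1) (g₁ : BdSpace E lam theta)
    (g₂ : BdSpace E theta lam) :
    ∃ x y : NetL2 d (fun _ : E => 0) (fun _ : E => 1),
      IsMaxPair (spectralMatrix S (signedDiag lam theta)) x y ∧ HasTraces S x g₁ g₂ := by
  set P := spectralMatrix S (signedDiag lam theta) with hP
  set L := LinearMap.toContinuousLinearMap (liftComponents S lam theta) with hL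
  -- At `0` the positive components are prescribed by `g₁` and the negative ones by `g₂`; at `1` the
  -- roles are exchanged.
  set v : E → EuclideanSpace ℂ (Fin d) := fun e => L (g₁.fst e, g₂.fst e) with hv
  set w : E → EuclideanSpace ℂ (Fin d) := fun e => L (g₂.snd e, g₁.snd e) with hw
  have hLb : ∀ (g : WSpace lam) (h : WSpace theta), ‖L (g, h)‖ ≤ ‖L‖ * (‖g‖ + ‖h‖) := fun g h => by
    refine (L.le_opNorm _).trans (mul_le_mul_of_nonneg_left ?_ (norm_nonneg _))
    exact max_le (le_add_of_nonneg_right (norm_nonneg _)) (le_add_of_nonneg_left (norm_nonneg _))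
  have hvm : Memℓp v 2 := memℓp_of_norm_le g₁.fst g₂.fst ‖L‖ fun e => hLb _ _
  have hwm : Memℓp w 2 := memℓp_of_norm_le g₂.snd g₁.snd ‖L‖ fun e => hLb _ _
  let v' : lp (fun _ : E => EuclideanSpace ℂ (Fin d)) 2 := ⟨v, hvm⟩
  let w' : lp (fun _ : E => EuclideanSpace ℂ (Fin d)) 2 := ⟨w, hwm⟩
  have hx : Memℓp (fun e => affineEdge (v e) (w e)) 2 :=
    memℓp_of_norm_le v' w' 1 fun e => by
      rw [one_mul]
      exact norm_affineEdge_le _ _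
  have hy : Memℓp (fun e => affineEdgeDeriv P (v e) (w e)) 2 :=
    memℓp_of_norm_le v' w' _ fun e => norm_affineEdgeDeriv_le _ _
  refine ⟨⟨_, hx⟩, ⟨_, hy⟩, fun e => hasWeakDeriv_affineEdge (v e) (w e), ?_⟩
  rw [hasTraces_iff]
  refine fun e => ⟨affineFun (v e) (w e), isContRep_affineEdge _ _, ?_⟩
  have h0 : affineFun (v e) (w e) 0 = v e := by simp [affineFun]
  have h1 : affineFun (v e) (w e) 1 = w e := by simp [affineFun]
  rw [h0, h1]
  exact ⟨(component_inl_lift hS' (g₁.fst e, g₂.fst e)).symm,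
    (component_inr_lift hS' (g₂.snd e, g₁.snd e)).symm,
    (component_inr_lift hS' (g₁.fst e, g₂.fst e)).symm,
    (component_inl_lift hS' (g₂.snd e, g₁.snd e)).symm⟩

lemma hasSum_norm_sq_lp {F : E → Type*} [∀ e, NormedAddCommGroup (F e)] (x : lp F 2) :
    HasSum (fun e => ‖x e‖ ^ 2) (‖x‖ ^ 2) := by
  have := lp.hasSum_norm (p := 2) (by norm_num) x
  simpa using this

/-- In the boundary form, positive components at `1` and negative components at `0` count positively
and the other two negatively; this dictates the grouping into `g₂` and `g₁`. -/
lemma re_green_traces (hS : Sᴴ * S = 1) (hS' : S * Sᴴ = 1)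
    {x y : NetL2 d (fun _ : E => 0) (fun _ : E => 1)}
    (h : IsMaxPair (spectralMatrix S (signedDiag lam theta)) x y)
    {g₁ : BdSpace E lam theta} {g₂ : BdSpace E theta lam} (hg : HasTraces S x g₁ g₂) :
    2 * (⟪y, x⟫_ℂ).re = ‖g₂‖ ^ 2 - ‖g₁‖ ^ 2 := by
  have hPQ := spectralMatrix_mul_inv (μ := signedDiag lam theta) hS hS' signedDiag_ne_zero
  choose u hu h1 h2 h3 h4 using hasTraces_iff.1 hg
  have hsum := Complex.hasSum_re (hasSum_green (fun _ : E => zero_lt_one)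
    isHermitian_spectralMatrix hPQ h h hu hu)
  simp only [Complex.sub_re, re_inner_spectralMatrix, ← h1, ← h2, ← h3, ← h4] at hsum
  have hsum' := ((hasSum_norm_sq_lp g₂.snd).sub (hasSum_norm_sq_lp g₁.snd)).sub
    ((hasSum_norm_sq_lp g₁.fst).sub (hasSum_norm_sq_lp g₂.fst))
  have key := hsum.unique hsum'
  have hsymm : (⟪x, y⟫_ℂ).re = (⟪y, x⟫_ℂ).re := inner_re_symm (𝕜 := ℂ) _ _
  rw [Complex.add_re, hsymm] at key
  rw [WithLp.prod_norm_sq_eq_of_L2, WithLp.prod_norm_sq_eq_of_L2]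
  linarith

lemma hasTraces_zero_of_mem {x y : NetL2 d (fun _ : E => 0) (fun _ : E => 1)}
    {P : Matrix (Fin d) (Fin d) ℂ} (h : (x, y) ∈ netGraph P (fun _ : E => 0) (fun _ : E => 1)) :
    HasTraces S x (0 : BdSpace E lam theta) 0 := by
  rw [hasTraces_iff]
  intro e
  obtain ⟨u, hu, h0, h1⟩ := (h e).2
  refine ⟨u, hu, ?_⟩
  simp only [h0, h1, map_zero]
  exact ⟨rfl, rfl, rfl, rfl⟩

/-- The boundary pair given by the boundary values. -/
lemma exists_trace_boundaryPair (hS : Sᴴ * S = 1) (hS' : S * Sᴴ = 1)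
    {P : Matrix (Fin d) (Fin d) ℂ} (hP : P = spectralMatrix S (signedDiag lam theta)) :
    ∃ (Γ₁ : (modelOp E P)†.domain →ₗ[ℂ] BdSpace E lam theta)
      (Γ₂ : (modelOp E P)†.domain →ₗ[ℂ] BdSpace E theta lam),
      IsBoundaryPair (-modelOp E P) ((modelOp E P)†) Γ₁ Γ₂ 2⁻¹ ∧
        ∀ x : (modelOp E P)†.domain, HasTraces S (x : NetL2 d (fun _ : E => 0) (fun _ : E => 1)) (Γ₁ x) (Γ₂ x) := by
  subst hP
  set P := spectralMatrix S (signedDiag lam theta) with hP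
  have hPQ := spectralMatrix_mul_inv (μ := signedDiag lam theta) hS hS' signedDiag_ne_zero
  have hherm : P.IsHermitian := isHermitian_spectralMatrix
  have h01 : ∀ _ : E, (0 : ℝ) < 1 := fun _ => zero_lt_one
  have hmax : ∀ x : (modelOp E P)†.domain, IsMaxPair P (x : NetL2 d _ _) (-(modelOp E P)† x) :=
    fun x => (mem_netOp_adjoint_graph h01 hherm hPQ).1 (LinearPMap.mem_graph _ x)
  choose g₁ g₂ hg using fun x => exists_hasTraces hS hS' (hmax x)
  let Γ₁ : (modelOp E P)†.domain →ₗ[ℂ] BdSpace E lam theta :=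
    { toFun := g₁
      map_add' := fun x y => ((hg (x + y)).unique ((hg x).add (hg y))).1
      map_smul' := fun c x => ((hg (c • x)).unique ((hg x).smul c)).1 }
  let Γ₂ : (modelOp E P)†.domain →ₗ[ℂ] BdSpace E theta lam :=
    { toFun := g₂
      map_add' := fun x y => ((hg (x + y)).unique ((hg x).add (hg y))).2
      map_smul' := fun c x => ((hg (c • x)).unique ((hg x).smul c)).2 }
  have hskew := neg_netOp_le_adjoint (a := fun _ : E => 0) (b := fun _ : E => 1) h01 hherm hPQ
  have hz : ∀ x : (modelOp E P)†.domain, (x : NetL2 d _ _) ∈ (-modelOp E P).domain →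
      g₁ x = 0 ∧ g₂ x = 0 := fun x hx => by
    have hx' : ((x : NetL2 d _ _), modelOp E P ⟨x, hx⟩) ∈ netGraph P _ _ := by
      rw [← netOp_graph]
      exact LinearPMap.mem_graph (modelOp E P) ⟨x, hx⟩
    exact (hg x).unique (hasTraces_zero_of_mem hx')
  refine ⟨Γ₁, Γ₂, ⟨by norm_num, fun x => ?_, fun k₁ k₂ => ?_, hskew, fun x hx => (hz x hx).1,
    fun x hx => (hz x hx).2, fun H => le_adjoint_of_dissipative (dense_netOp_domain h01) hskew⟩, hg⟩
  · have := re_green_traces hS hS' (hmax x) (hg x)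
    rw [inner_neg_left, Complex.neg_re] at this
    change _ = 2⁻¹ * (‖g₁ x‖ ^ 2 - ‖g₂ x‖ ^ 2)
    linarith
  · obtain ⟨x, y, hxy, hk⟩ := exists_isMaxPair_hasTraces (E := E) hS' k₁ k₂
    have hx : (x, -y) ∈ (modelOp E P)†.graph := by
      rw [mem_netOp_adjoint_graph h01 hherm hPQ, neg_neg]
      exact hxy
    have hd := LinearPMap.mem_domain_of_mem_graph hx
    exact ⟨⟨x, hd⟩, ((hg ⟨x, hd⟩).unique hk)⟩

end Traces

/-! ### Comparison of the two networks -/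

section Main

open scoped LinearPMap

variable {E : Type*} {d : ℕ} {a b : E → ℝ} {P Q : Matrix (Fin d) (Fin d) ℂ}

/-- The kernel is the solution space of `(P x)' = -σ x` with `σ = 1`; the casts match the form in
which `exists_unitaryCopy` takes `σ`. -/
lemma mem_kerOneSub_netOp (hab : ∀ e, a e < b e) (hP : P.IsHermitian) (hPQ : P * Q = 1)
    (x : NetL2 d a b) :
    x ∈ kerOneSub ((netOp P a b)†) ↔ IsMaxPair P x ((-((1 : ℝ) : ℂ)) • x) := by
  rw [mem_kerOneSub_iff, mem_netOp_adjoint_graph hab hP hPQ]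
  simp

lemma mem_kerOneAdd_netOp (hab : ∀ e, a e < b e) (hP : P.IsHermitian) (hPQ : P * Q = 1)
    (x : NetL2 d a b) :
    x ∈ kerOneAdd ((netOp P a b)†) ↔ IsMaxPair P x ((-((-1 : ℝ) : ℂ)) • x) := by
  rw [mem_kerOneAdd_iff, mem_netOp_adjoint_graph hab hP hPQ]
  simp

/-- The domain of an extension in terms of Von Neumann's decomposition. -/
lemma mem_boundaryRestrict_iff_decomposition {X : Type*} [NormedAddCommGroup X]
    [InnerProductSpace ℂ X] [CompleteSpace X] {A : X →ₗ.[ℂ] X} {G₁ G₂ : Type*}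
    [NormedAddCommGroup G₁] [InnerProductSpace ℂ G₁] [NormedAddCommGroup G₂]
    [InnerProductSpace ℂ G₂] (hA : Dense (A.domain : Set X)) (hskew : -A ≤ A†) (hcl : A.IsClosed)
    {Γ₁ : A†.domain →ₗ[ℂ] kerOneSub (A†)} {Γ₂ : A†.domain →ₗ[ℂ] kerOneAdd (A†)}
    (hΓ : ∀ (x : A†.domain) (x₀ : A.domain) (x₁ : kerOneSub (A†)) (x₂ : kerOneAdd (A†)),
      (x : X) = x₀ + x₁ + x₂ → Γ₁ x = x₁ ∧ Γ₂ x = x₂)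
    (U₁ : kerOneSub (A†) →ₗ[ℂ] G₁) (U₂ : kerOneAdd (A†) →ₗ[ℂ] G₂) (T : G₂ →L[ℂ] G₁) {x : X} :
    x ∈ (boundaryRestrict (A†) (U₁ ∘ₗ Γ₁) (U₂ ∘ₗ Γ₂) T).domain ↔
      ∃ x₀ ∈ A.domain, ∃ (x₁ : kerOneSub (A†)) (x₂ : kerOneAdd (A†)),
        x = x₀ + x₁ + x₂ ∧ T (U₂ x₂) = U₁ x₁ := by
  rw [mem_boundaryRestrict]
  constructor
  · rintro ⟨hx, h⟩
    obtain ⟨x₀, y₀, h0, x₁, hx₁, x₂, hx₂, hdec⟩ :=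
      exists_deficiency_decomposition hA hskew hcl (LinearPMap.mem_graph _ ⟨x, hx⟩)
    have hd := LinearPMap.mem_domain_of_mem_graph h0
    obtain ⟨e₁, e₂⟩ := hΓ ⟨x, hx⟩ ⟨x₀, hd⟩ ⟨x₁, hx₁⟩ ⟨x₂, hx₂⟩ hdec
    refine ⟨x₀, hd, ⟨x₁, hx₁⟩, ⟨x₂, hx₂⟩, hdec, ?_⟩
    rw [← e₁, ← e₂]
    exact h
  · rintro ⟨x₀, h0, x₁, x₂, hdec, h⟩
    have hx : x ∈ A†.domain := by
      rw [hdec]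
      exact add_mem (add_mem (hskew.1 h0)
        (LinearPMap.mem_domain_of_mem_graph (mem_kerOneSub_iff.1 x₁.2)))
        (LinearPMap.mem_domain_of_mem_graph (mem_kerOneAdd_iff.1 x₂.2))
    obtain ⟨e₁, e₂⟩ := hΓ ⟨x, hx⟩ ⟨x₀, h0⟩ x₁ x₂ hdec
    refine ⟨hx, ?_⟩
    rw [LinearMap.comp_apply, LinearMap.comp_apply, e₁, e₂]
    exact h

/-- Von Neumann's formula for the domain of an extension. -/
lemma mem_boundaryRestrict_iff_exists_add {X : Type*} [NormedAddCommGroup X]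
    [InnerProductSpace ℂ X] [CompleteSpace X] {A : X →ₗ.[ℂ] X}
    (hA : Dense (A.domain : Set X)) (hskew : -A ≤ A†) (hcl : A.IsClosed)
    {Γ₁ : A†.domain →ₗ[ℂ] kerOneSub (A†)} {Γ₂ : A†.domain →ₗ[ℂ] kerOneAdd (A†)}
    (hΓ : ∀ (x : A†.domain) (x₀ : A.domain) (x₁ : kerOneSub (A†)) (x₂ : kerOneAdd (A†)),
      (x : X) = x₀ + x₁ + x₂ → Γ₁ x = x₁ ∧ Γ₂ x = x₂)
    (T : kerOneAdd (A†) →L[ℂ] kerOneSub (A†)) (y : X) :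
    y ∈ (boundaryRestrict (A†) Γ₁ Γ₂ T).domain ↔
      ∃ y₀ ∈ A.domain, ∃ y₂ : kerOneAdd (A†), y = y₀ + T y₂ + y₂ := by
  refine (mem_boundaryRestrict_iff_decomposition hA hskew hcl hΓ
    LinearMap.id LinearMap.id T).trans ?_
  constructor
  · rintro ⟨y₀, h0, y₁, y₂, hy, h⟩
    have h' : T y₂ = y₁ := h
    exact ⟨y₀, h0, y₂, by rw [h', hy]⟩
  · rintro ⟨y₀, h0, y₂, hy⟩
    exact ⟨y₀, h0, T y₂, y₂, hy, rfl⟩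

end Main

set_option maxHeartbeats 2000000 in
open scoped LinearPMap in
theorem corollary6p9 {E : Type*} [Countable E] {d np nm : ℕ}
    (P₁ : Matrix (Fin d) (Fin d) ℂ) (S : Matrix (Fin np ⊕ Fin nm) (Fin d) ℂ)
    (lam : Fin np → Ioi (0 : ℝ)) (theta : Fin nm → Ioi (0 : ℝ))
    (hS : Sᴴ * S = 1) (hS' : S * Sᴴ = 1)
    (hP₁ : P₁ = Sᴴ * diagonal (fun k => (signedDiag lam theta k : ℂ)) * S)
    (a b : E → ℝ) (hab : ∀ e, a e < b e) :
    (∀ x ∈ ((modelOp E P₁)†).domain,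
      ∃ (g₁ : BdSpace E lam theta) (g₂ : BdSpace E theta lam), HasTraces S x g₁ g₂) ∧
    ∃ Φ : MaxDissExt (-netOp P₁ a b) ≃ MaxDissExt (-modelOp E P₁),
      (∀ H : MaxDissExt (-netOp P₁ a b),
        ∃ T : kerOneAdd ((modelOp E P₁)†) →L[ℂ] kerOneSub ((modelOp E P₁)†), ‖T‖ ≤ 1 ∧
          (∀ x, x ∈ H.1.domain ↔
            ∃ x₀ ∈ (netOp P₁ a b).domain, ∃ x₁ ∈ kerOneSub ((netOp P₁ a b)†),
              ∃ x₂ ∈ kerOneAdd ((netOp P₁ a b)†), x = x₀ + x₁ + x₂ ∧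
                ∃ y₂ : kerOneAdd ((modelOp E P₁)†),
                  IsUnitaryCopy S (signedDiag lam theta) a b (-1) x₂ y₂ ∧
                  IsUnitaryCopy S (signedDiag lam theta) a b 1 x₁ (T y₂)) ∧
          (∀ y, y ∈ (Φ H).1.domain ↔
            ∃ y₀ ∈ (modelOp E P₁).domain, ∃ y₂ : kerOneAdd ((modelOp E P₁)†),
              y = y₀ + T y₂ + y₂)) ∧
      ∀ H : MaxDissExt (-netOp P₁ a b),
        ∃! T : BdSpace E theta lam →L[ℂ] BdSpace E lam theta, ‖T‖ ≤ 1 ∧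
          ∀ x, x ∈ (Φ H).1.domain ↔
            x ∈ ((modelOp E P₁)†).domain ∧
              ∃ (g₁ : BdSpace E lam theta) (g₂ : BdSpace E theta lam),
                HasTraces S x g₁ g₂ ∧ T g₂ = g₁ := by
  have hP : P₁ = spectralMatrix S (signedDiag lam theta) := hP₁
  clear hP₁
  have hμ := signedDiag_ne_zero (lam := lam) (theta := theta)
  have hherm : P₁.IsHermitian := hP ▸ isHermitian_spectralMatrix
  have hPQ : P₁ * spectralMatrix S (fun k => (signedDiag lam theta k)⁻¹) = 1 := by
    rw [hP]
    exact spectralMatrix_mul_inv hS hS' hμ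
  have h01 : ∀ _ : E, (0 : ℝ) < 1 := fun _ => zero_lt_one
  have hd := dense_netOp_domain (P := P₁) hab
  have hd' := dense_netOp_domain (P := P₁) h01
  have hs := neg_netOp_le_adjoint hab hherm hPQ
  have hs' := neg_netOp_le_adjoint h01 hherm hPQ
  have hc := isClosed_netOp hab hherm hPQ
  have hc' := isClosed_netOp h01 hherm hPQ
  have : CompleteSpace (kerOneSub ((netOp P₁ a b)†)) :=
    (isClosed_kerOneSub_adjoint hd).completeSpace_coe
  have : CompleteSpace (kerOneAdd ((netOp P₁ a b)†)) :=
    (isClosed_kerOneAdd_adjoint hd).completeSpace_coe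
  have : CompleteSpace (kerOneSub ((modelOp E P₁)†)) :=
    (isClosed_kerOneSub_adjoint hd').completeSpace_coe
  have : CompleteSpace (kerOneAdd ((modelOp E P₁)†)) :=
    (isClosed_kerOneAdd_adjoint hd').completeSpace_coe
  obtain ⟨U₁, hU₁⟩ := exists_unitaryCopy (K := kerOneSub ((netOp P₁ a b)†))
    (K' := kerOneSub ((modelOp E P₁)†)) (S := S) (μ := signedDiag lam theta) (σ := 1)
    (by rw [← hP]; exact mem_kerOneSub_netOp hab hherm hPQ) hS hS' hab hμ (by norm_num)
    (by rw [← hP]; exact mem_kerOneSub_netOp h01 hherm hPQ)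
  obtain ⟨U₂, hU₂⟩ := exists_unitaryCopy (K := kerOneAdd ((netOp P₁ a b)†))
    (K' := kerOneAdd ((modelOp E P₁)†)) (S := S) (μ := signedDiag lam theta) (σ := -1)
    (by rw [← hP]; exact mem_kerOneAdd_netOp hab hherm hPQ) hS hS' hab hμ (by norm_num)
    (by rw [← hP]; exact mem_kerOneAdd_netOp h01 hherm hPQ)
  obtain ⟨Γ₁, Γ₂, hΓ, hdec⟩ := exists_deficiency_boundaryPair hd hs hc
  obtain ⟨Γ₁', Γ₂', hΓ', hdec'⟩ := exists_deficiency_boundaryPair hd' hs' hc'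
  obtain ⟨γ₁, γ₂, hγ, htr⟩ := exists_trace_boundaryPair (E := E) hS hS' hP
  -- With the unitaries built in, the boundary pair of `A` takes values in the deficiency spaces of
  -- `Ã`. Both parametrizations then start from the same set of contractions, and `Φ` is one
  -- inverted and followed by the other.
  have hA := hΓ.comp U₁ U₂
  refine ⟨fun x hx => ⟨_, _, htr ⟨x, hx⟩⟩, hA.paramEquiv.symm.trans hΓ'.paramEquiv,
    fun H => ?_, fun H => ?_⟩
  · obtain ⟨T, rfl⟩ := hA.paramEquiv.surjective H
    refine ⟨T.1, T.2, fun x => ?_, fun y => ?_⟩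
    · refine (mem_boundaryRestrict_iff_decomposition hd hs hc hdec
        U₁.toLinearEquiv.toLinearMap U₂.toLinearEquiv.toLinearMap T.1).trans ?_
      constructor
      · rintro ⟨x₀, h0, x₁, x₂, hx, h⟩
        refine ⟨x₀, h0, x₁, x₁.2, x₂, x₂.2, hx, U₂ x₂, (hU₂ _ _).2 rfl, (hU₁ _ _).2 h⟩
      · rintro ⟨x₀, h0, x₁, hx₁, x₂, hx₂, hx, y₂, hy, hTy⟩
        refine ⟨x₀, h0, ⟨x₁, hx₁⟩, ⟨x₂, hx₂⟩, hx, ?_⟩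
        have e₂ := (hU₂ ⟨x₂, hx₂⟩ y₂).1 hy
        have e₁ := (hU₁ ⟨x₁, hx₁⟩ (T.1 y₂)).1 hTy
        rw [e₂] at e₁
        exact e₁
    · have hval : ((hA.paramEquiv.symm.trans hΓ'.paramEquiv) (hA.paramEquiv T)).1 =
          boundaryRestrict ((modelOp E P₁)†) Γ₁' Γ₂' T.1 :=
        congrArg (fun t => (hΓ'.paramEquiv t).1) (hA.paramEquiv.symm_apply_apply T)
      rw [hval]
      exact mem_boundaryRestrict_iff_exists_add hd' hs' hc' hdec' T.1 y
  · set H' := (hA.paramEquiv.symm.trans hΓ'.paramEquiv) H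
    have hiff : ∀ (T : BdSpace E theta lam →L[ℂ] BdSpace E lam theta) x,
        x ∈ (boundaryRestrict ((modelOp E P₁)†) γ₁ γ₂ T).domain ↔
          x ∈ ((modelOp E P₁)†).domain ∧
            ∃ (g₁ : BdSpace E lam theta) (g₂ : BdSpace E theta lam),
              HasTraces S x g₁ g₂ ∧ T g₂ = g₁ := by
      intro T x
      rw [mem_boundaryRestrict]
      constructor
      · rintro ⟨hx, h⟩
        exact ⟨hx, _, _, htr ⟨x, hx⟩, h⟩
      · rintro ⟨hx, g₁, g₂, hg, h⟩
        obtain ⟨e₁, e₂⟩ := (htr ⟨x, hx⟩).unique hg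
        exact ⟨hx, by rw [e₁, e₂, h]⟩
    -- The trace parameter of `Φ H` comes from the same abstract result, applied to the trace
    -- boundary pair.
    obtain ⟨T, hT, hTH⟩ := hγ.exists_eq_boundaryRestrict H'.2
    refine ⟨T, ⟨hT, fun x => ?_⟩, fun T' hT' => ?_⟩
    · rw [← hTH]
      exact hiff T x
    · refine hγ.parameter_unique fun x hx => ?_
      rw [hTH]
      exact (hT'.2 x).2 ((hiff T' x).1 hx)
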